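/- Let $E=(E^0,E^1,r,s)$ be a row-finite directed graph (every vertex emits only finitely many edges; $E^0$ and $E^1$ may be infinite), let $K$ be a field, and let $L_K(E)$ be the Leavitt path algebra: the (not necessarily unital) associative $K$-algebra generated by pairwise orthogonal idempotents $v\in E^0$ and elements $e,e^*$ ($e\in E^1$) subject to $s(e)e=e\,r(e)=e$, $r(e)e^*=e^*s(e)=e^*$, $e^*f=\delta_{e,f}\,r(e)$ for $e,f\in E^1$, and $v=\sum_{s(e)=v}ee^*$ for every $v\in E^0$ with $s^{-1}(v)\neq\emptyset$. It is $\mathbb Z$-graded by giving the elements $v,e,e^*$ the degrees $0,1,-1$. A prime ideal is a proper two-sided ideal $P$ such that $IJ\subseteq P$ implies $I\subseteq P$ or $J\subseteq P$ for two-sided ideals $I,J$; an ideal is graded if each of its elements is a sum of homogeneous elements of the ideal; an ideal is primitive if it is the annihilator of a simple right module (that is, a right module $S$ with $S\cdot L_K(E)\neq 0$ and no submodules other than $0$ and $S$). For $v,w\in E^0$ write $v\ge w$ if $v=w$ or there is a path from $v$ to $w$. A cycle is a closed path $e_1\cdots e_n$ ($n\ge 1$) with pairwise distinct sources $s(e_i)$;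 an exit for it is an edge $f$ with $s(f)=s(e_i)$ and $f\neq e_i$ for some $i$. A maximal tail is a nonempty set $M\subseteq E^0$ such that (1) $w\in M$ and $v\ge w$ imply $v\in M$; (2) every $v\in M$ with $s^{-1}(v)\ne\emptyset$ emits an edge $e$ with $r(e)\in M$; (3) for all $v,w\in M$ there is $y\in M$ with $v\ge y$ and $w\ge y$. An edge, or a cycle, is in $M$ if the sources and ranges of its edges are in $M$. (i) Let $P$ be a graded prime ideal of $L_K(E)$ and let $M=E^0\setminus(P\cap E^0)$. Then $M$ is a maximal tail, and $P$ is primitive if and only if $M\in\mathcal M_\gamma(E)$, that is, $M$ is a maximal tail such that every cycle in $M$ has an exit in $M$. (ii) Every non-graded prime ideal of $L_K(E)$ is primitive. -/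

import Mathlib

universe u v w

/-- A directed graph with vertex set `V` and edge set `X`, given by the source and range maps;
loops and parallel edges are allowed. -/
structure DirectedGraph (V : Type u) (X : Type v) where
  /-- the source map `s` -/
  src : X → V
  /-- the range map `r` -/
  rng : X → V

namespace DirectedGraph

variable {V : Type u} {X : Type v} (E : DirectedGraph V X)

/-- Every vertex emits only finitely many edges. -/
def RowFinite : Prop := ∀ a : V, (E.src ⁻¹' {a}).Finite

/-- `E.IsPath a p b`: the list of edges `p` is a path from `a` to `b`
(the empty list is the trivial path at a vertex). -/
def IsPath : V → List X → V → Prop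
  | a, [], b => a = b
  | a, e :: p, b => E.src e = a ∧ IsPath (E.rng e) p b

/-- The relation `a ≥ b`: either `a = b`, or there is a path of positive length
from `a` to `b`. -/
def Reaches (a b : V) : Prop := ∃ p : List X, E.IsPath a p b

/-- A cycle: a closed path of positive length whose edges have pairwise distinct sources. -/
def IsCycle (c : List X) : Prop :=
  c ≠ [] ∧ (∃ a : V, E.IsPath a c a) ∧ (c.map E.src).Nodup

/-- `f` is an exit for the path `p`: for some edge `e` of `p` we have `s(f) = s(e)`, `f ≠ e`. -/
def IsExit (f : X) (p : List X) : Prop := ∃ e ∈ p, E.src f = E.src e ∧ f ≠ e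

/-- The edge `e` lies in the full subgraph on the vertex set `M`. -/
def EdgeIn (M : Set V) (e : X) : Prop := E.src e ∈ M ∧ E.rng e ∈ M

/-- Every cycle in (the full subgraph on) `M` has an exit in `M`. -/
def CyclesHaveExitsIn (M : Set V) : Prop :=
  ∀ c : List X, E.IsCycle c → (∀ e ∈ c, E.EdgeIn M e) → ∃ f : X, E.EdgeIn M f ∧ E.IsExit f c

/-- Maximal tails. -/
structure IsMaximalTail (M : Set V) : Prop where
  nonempty : M.Nonempty
  mem_of_reaches : ∀ a b : V, b ∈ M → E.Reaches a b → a ∈ M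
  exists_edge : ∀ a ∈ M, (E.src ⁻¹' {a}).Nonempty → ∃ e : X, E.src e = a ∧ E.rng e ∈ M
  directed : ∀ a ∈ M, ∀ b ∈ M, ∃ y ∈ M, E.Reaches a y ∧ E.Reaches b y

/-- The set `𝓜(E)` of maximal tails. -/
def maximalTails : Set (Set V) := {M | E.IsMaximalTail M}

/-- The set `𝓜_γ(E)` of the maximal tails `M` such that every cycle in `M` has an exit in `M`. -/
def maximalTailsGamma : Set (Set V) := {M ∈ E.maximalTails | E.CyclesHaveExitsIn M}

end DirectedGraph

/-- The generators `a ∈ E⁰`, `e ∈ E¹` and `e* ∈ (E¹)*` of the Leavitt path algebra. -/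
inductive LeavittGen (V : Type u) (X : Type v) : Type (max u v)
  | vertex : V → LeavittGen V X
  | edge : X → LeavittGen V X
  | ghost : X → LeavittGen V X

/-- The weights `0`, `1`, `-1` of the generators. -/
def LeavittGen.weight {V : Type u} {X : Type v} : LeavittGen V X → ℤ
  | vertex _ => 0
  | edge _ => 1
  | ghost _ => -1

/-- The free associative `K`-algebra without unit on the generators: the semigroup algebra of the
free semigroup of nonempty words. -/
abbrev FreeLeavitt (K : Type w) [Field K] (V : Type u) (X : Type v) : Type (max u v w) :=
  MonoidAlgebra K (FreeSemigroup (LeavittGen V X))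

section Construction

variable (K : Type w) [Field K] {V : Type u} {X : Type v} (E : DirectedGraph V X)

/-- A generator as an element of the free algebra. -/
noncomputable def freeGen (g : LeavittGen V X) : FreeLeavitt K V X :=
  MonoidAlgebra.single (FreeSemigroup.of g) 1

open LeavittGen in
/-- The defining relations of the Leavitt path algebra. The relation `ck2` is imposed at the
vertices that emit at least one and only finitely many edges; in a row-finite graph these are all
the vertices that are not sinks. -/
inductive LeavittRel : FreeLeavitt K V X → FreeLeavitt K V X → Prop
  | vertex_idem (a : V) :
      LeavittRel (freeGen K (vertex a) * freeGen K (vertex a)) (freeGen K (vertex a))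
  | vertex_orth (a b : V) (hab : a ≠ b) :
      LeavittRel (freeGen K (vertex a) * freeGen K (vertex b)) 0
  | src_edge (e : X) :
      LeavittRel (freeGen K (vertex (E.src e)) * freeGen K (edge e)) (freeGen K (edge e))
  | edge_rng (e : X) :
      LeavittRel (freeGen K (edge e) * freeGen K (vertex (E.rng e))) (freeGen K (edge e))
  | rng_ghost (e : X) :
      LeavittRel (freeGen K (vertex (E.rng e)) * freeGen K (ghost e)) (freeGen K (ghost e))
  | ghost_src (e : X) :
      LeavittRel (freeGen K (ghost e) * freeGen K (vertex (E.src e))) (freeGen K (ghost e))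
  | ck1_same (e : X) :
      LeavittRel (freeGen K (ghost e) * freeGen K (edge e)) (freeGen K (vertex (E.rng e)))
  | ck1_ne (e f : X) (hef : e ≠ f) :
      LeavittRel (freeGen K (ghost e) * freeGen K (edge f)) 0
  | ck2 (a : V) (hfin : (E.src ⁻¹' {a}).Finite) (hne : (E.src ⁻¹' {a}).Nonempty) :
      LeavittRel (freeGen K (vertex a))
        (∑ e ∈ hfin.toFinset, freeGen K (edge e) * freeGen K (ghost e))

/-- The congruence of `K`-algebras generated by the defining relations: the ring congruence
generated by all scalar multiples of the relations. -/
noncomputable def leavittCon : RingCon (FreeLeavitt K V X) :=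
  ringConGen fun x y => ∃ (k : K) (x' y' : FreeLeavitt K V X),
    LeavittRel K E x' y' ∧ x = k • x' ∧ y = k • y'

theorem leavittCon_smul (k : K) {x y : FreeLeavitt K V X} (h : leavittCon K E x y) :
    leavittCon K E (k • x) (k • y) := by
  change RingConGen.Rel _ x y at h
  induction h with
  | of x y h =>
    obtain ⟨l, x', y', h, rfl, rfl⟩ := h
    exact RingConGen.Rel.of _ _ ⟨k * l, x', y', h, (mul_smul ..).symm, (mul_smul ..).symm⟩
  | refl x => exact (leavittCon K E).refl _
  | symm _ ih => exact (leavittCon K E).symm ih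
  | trans _ _ ih₁ ih₂ => exact (leavittCon K E).trans ih₁ ih₂
  | add _ _ ih₁ ih₂ => rw [smul_add, smul_add]; exact (leavittCon K E).add ih₁ ih₂
  | mul _ h₂ ih₁ _ =>
    rw [← smul_mul_assoc, ← smul_mul_assoc]
    exact (leavittCon K E).mul ih₁ h₂

/-- The Leavitt path algebra `L_K(E)`, an associative `K`-algebra, in general without unit. -/
def LeavittPathAlgebra : Type (max u v w) := (leavittCon K E).Quotient

namespace LeavittPathAlgebra

noncomputable instance : NonUnitalRing (LeavittPathAlgebra K E) :=
  inferInstanceAs (NonUnitalRing (leavittCon K E).Quotient)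

/-- The projection from the free algebra. -/
noncomputable def mk : FreeLeavitt K V X →ₙ+* LeavittPathAlgebra K E where
  toFun x := (x : (leavittCon K E).Quotient)
  map_mul' _ _ := rfl
  map_zero' := rfl
  map_add' _ _ := rfl

theorem mk_surjective : Function.Surjective (mk K E) := fun x => Quotient.exists_rep x

noncomputable instance : SMul K (LeavittPathAlgebra K E) where
  smul k := Quotient.map' (k • ·) fun _ _ h => leavittCon_smul K E k h

theorem mk_smul (k : K) (x : FreeLeavitt K V X) : mk K E (k • x) = k • mk K E x := rfl

noncomputable instance : Module K (LeavittPathAlgebra K E) :=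
  Function.Surjective.module K (mk K E : FreeLeavitt K V X →+ LeavittPathAlgebra K E)
    (mk_surjective K E) (mk_smul K E)

instance : IsScalarTower K (LeavittPathAlgebra K E) (LeavittPathAlgebra K E) where
  smul_assoc k x y := by
    obtain ⟨x, rfl⟩ := mk_surjective K E x
    obtain ⟨y, rfl⟩ := mk_surjective K E y
    simp only [smul_eq_mul]
    rw [← mk_smul, ← map_mul, ← map_mul, ← mk_smul, smul_mul_assoc]

instance : SMulCommClass K (LeavittPathAlgebra K E) (LeavittPathAlgebra K E) where
  smul_comm k x y := by
    obtain ⟨x, rfl⟩ := mk_surjective K E x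
    obtain ⟨y, rfl⟩ := mk_surjective K E y
    simp only [smul_eq_mul]
    rw [← mk_smul, ← map_mul, ← map_mul, ← mk_smul, mul_smul_comm]

/-- The vertex `a` as an element of `L_K(E)`. -/
noncomputable def vertex (a : V) : LeavittPathAlgebra K E := mk K E (freeGen K (.vertex a))

/-- The weight of a word in the generators: the sum of the weights of its letters. -/
def wordWeight : FreeSemigroup (LeavittGen V X) →ₙ* Multiplicative ℤ :=
  FreeSemigroup.lift fun g => Multiplicative.ofAdd g.weight

/-- The homogeneous component of degree `n` of the `ℤ`-grading of `L_K(E)`: the span of the words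
of weight `n` in the generators. -/
noncomputable def component (n : ℤ) : Submodule K (LeavittPathAlgebra K E) :=
  Submodule.span K
    {x | ∃ m : FreeSemigroup (LeavittGen V X),
      wordWeight m = Multiplicative.ofAdd n ∧ x = mk K E (MonoidAlgebra.single m 1)}

variable {K E}

/-- A graded ideal: every element is a finite sum of homogeneous elements of the ideal. -/
def IsGradedIdeal (P : TwoSidedIdeal (LeavittPathAlgebra K E)) : Prop :=
  ∀ x ∈ P, ∃ c : ℤ →₀ LeavittPathAlgebra K E,
    (∀ n, c n ∈ component K E n ∧ c n ∈ P) ∧ x = c.sum fun _ y => y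

/-- The set `E⁰ \ (P ∩ E⁰)` of the vertices that do not lie in `P`. -/
def verticesOutside (P : TwoSidedIdeal (LeavittPathAlgebra K E)) : Set V :=
  {a | vertex K E a ∉ P}

end LeavittPathAlgebra

end Construction

/-- Prime two-sided ideals of a ring, possibly without unit: proper ideals `P` such that
`I J ⊆ P` implies `I ⊆ P` or `J ⊆ P` for all two-sided ideals `I` and `J`. -/
def IsPrimeTwoSided {A : Type u} [NonUnitalRing A] (P : TwoSidedIdeal A) : Prop :=
  P ≠ ⊤ ∧ ∀ I J : TwoSidedIdeal A, (∀ x ∈ I, ∀ y ∈ J, x * y ∈ P) → I ≤ P ∨ J ≤ P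

/-- A right module over a ring `A`, possibly without unit, is an additive group `S` with a ring
homomorphism `ρ : Aᵐᵒᵖ → End(S)`, where `s · a` is `ρ (op a) s`. It is simple if `S A ≠ 0` and the
only submodules are `0` and `S`. -/
def IsSimpleRightModule {A : Type u} [NonUnitalRing A] {S : Type v} [AddCommGroup S]
    (ρ : Aᵐᵒᵖ →ₙ+* AddMonoid.End S) : Prop :=
  (∃ (a : A) (s : S), ρ (MulOpposite.op a) s ≠ 0) ∧
    ∀ N : AddSubgroup S, (∀ (a : A), ∀ s ∈ N, ρ (MulOpposite.op a) s ∈ N) → N = ⊥ ∨ N = ⊤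

/-- (Right) primitive ideals: the annihilators of the simple right modules. (A simple right module
`S` is a quotient `s A` of `A`, so that the universe of `A` is enough.) -/
def IsPrimitiveIdeal {A : Type u} [NonUnitalRing A] (P : TwoSidedIdeal A) : Prop :=
  ∃ (S : Type u) (_ : AddCommGroup S) (ρ : Aᵐᵒᵖ →ₙ+* AddMonoid.End S),
    IsSimpleRightModule ρ ∧ ∀ a : A, a ∈ P ↔ ρ (MulOpposite.op a) = 0

/-! Write `A` for the algebra and `M` for the set of vertices outside the prime `P`. Primeness,
tested on the spanning elements `p q*`, makes `M` a maximal tail. The rest depends on the cycles in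
`M`.

If every cycle in `M` has an exit in `M`, then `P` is primitive, graded or not. Each element outside
`P` can be multiplied into `k v + z` with `k ≠ 0`, `v ∉ P` and `z` a combination of closed paths at
`v` (`exists_reduction`). Conjugating by a path that leaves through exits kills `z`, so every ideal
not contained in `P` contains a vertex of `M` (`exists_vertex_mem_of_notMem`). Row-finiteness and
directedness give paths `p 0, p 1, ...` from one vertex, each extending the last, that pass below
every vertex of `M` they could reach. The right ideal of all `x` with some `(p n)* x ∈ P` then
satisfies the criterion `isPrimitiveIdeal_of_rightIdeal`.

Otherwise some cycle `c` at `a` has no exit in `M`. Modulo `P`, the element `c` is invertible in the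
corner `a A a`, and this corner is a quotient of the Laurent polynomials in `c` (`exists_pathEval`).
Powers of `c` clear denominators, so only `K[X]` and `evalIdeal`, the polynomials `f` with `f(c) ∈
P`, are used. If `P` is not graded, `evalIdeal` is a nonzero prime, hence maximal, so the corner
modulo `P` is a field and `P` is primitive. If `P` is graded, `evalIdeal` is zero, and a faithful
simple module over `A / P` would make the non-unit `1 - c` act invertibly on a suitable vector,
which is impossible. -/

namespace LeavittPathAlgebra

variable {K : Type w} [Field K] {V : Type u} {X : Type v} {E : DirectedGraph V X}

/-! ### Generators and their relations in the algebra -/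

theorem mk_eq_of_rel {x y : FreeLeavitt K V X} (h : LeavittRel K E x y) : mk K E x = mk K E y :=
  Quotient.sound (RingConGen.Rel.of _ _ ⟨1, x, y, h, (one_smul ..).symm, (one_smul ..).symm⟩)

variable (K E)

/-- The edge `e` as an element of `L_K(E)`. -/
noncomputable def edge (e : X) : LeavittPathAlgebra K E := mk K E (freeGen K (.edge e))

/-- The ghost edge `e*` as an element of `L_K(E)`. -/
noncomputable def ghost (e : X) : LeavittPathAlgebra K E := mk K E (freeGen K (.ghost e))

/-- The class of a word in the generators. -/
noncomputable def word (m : FreeSemigroup (LeavittGen V X)) : LeavittPathAlgebra K E :=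
  mk K E (MonoidAlgebra.single m 1)

theorem word_mul (m n : FreeSemigroup (LeavittGen V X)) :
    word K E (m * n) = word K E m * word K E n := by
  simp [word, ← map_mul]

variable {K E}

@[simp] theorem vertex_mul_self (a : V) : vertex K E a * vertex K E a = vertex K E a := by
  simpa [vertex] using mk_eq_of_rel (K := K) (E := E) (.vertex_idem a)

theorem vertex_mul_of_ne {a b : V} (h : a ≠ b) : vertex K E a * vertex K E b = 0 := by
  simpa [vertex] using mk_eq_of_rel (K := K) (E := E) (.vertex_orth a b h)

@[simp] theorem src_mul_edge (e : X) : vertex K E (E.src e) * edge K E e = edge K E e := by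
  simpa [vertex, edge] using mk_eq_of_rel (K := K) (E := E) (.src_edge e)

@[simp] theorem edge_mul_rng (e : X) : edge K E e * vertex K E (E.rng e) = edge K E e := by
  simpa [vertex, edge] using mk_eq_of_rel (K := K) (E := E) (.edge_rng e)

@[simp] theorem rng_mul_ghost (e : X) : vertex K E (E.rng e) * ghost K E e = ghost K E e := by
  simpa [vertex, ghost] using mk_eq_of_rel (K := K) (E := E) (.rng_ghost e)

@[simp] theorem ghost_mul_src (e : X) : ghost K E e * vertex K E (E.src e) = ghost K E e := by
  simpa [vertex, ghost] using mk_eq_of_rel (K := K) (E := E) (.ghost_src e)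

@[simp] theorem ghost_mul_edge (e : X) : ghost K E e * edge K E e = vertex K E (E.rng e) := by
  simpa [vertex, ghost, edge] using mk_eq_of_rel (K := K) (E := E) (.ck1_same e)

theorem ghost_mul_edge_of_ne {e f : X} (h : e ≠ f) : ghost K E e * edge K E f = 0 := by
  simpa [ghost, edge] using mk_eq_of_rel (K := K) (E := E) (.ck1_ne e f h)

theorem vertex_eq_sum {a : V} (hfin : (E.src ⁻¹' {a}).Finite) (hne : (E.src ⁻¹' {a}).Nonempty) :
    vertex K E a = ∑ e ∈ hfin.toFinset, edge K E e * ghost K E e := by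
  simpa [vertex, ghost, edge] using mk_eq_of_rel (K := K) (E := E) (.ck2 a hfin hne)

/-! ### Words -/

theorem word_induction {p : FreeSemigroup (LeavittGen V X) → Prop}
    (of : ∀ g, p (.of g)) (mul : ∀ g m, p m → p (.of g * m)) (m) : p m :=
  FreeSemigroup.recOnMul m of fun g m _ => mul g m

theorem mk_single (m : FreeSemigroup (LeavittGen V X)) (k : K) :
    mk K E (MonoidAlgebra.single m k) = k • word K E m := by
  rw [word, ← mk_smul, MonoidAlgebra.smul_single, smul_eq_mul, mul_one]

theorem mem_span_word (x : LeavittPathAlgebra K E) :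
    x ∈ Submodule.span K (Set.range (word K E)) := by
  obtain ⟨x, rfl⟩ := mk_surjective K E x
  induction x using MonoidAlgebra.induction_linear with
  | zero => rw [map_zero]; exact zero_mem _
  | add x y hx hy => rw [map_add]; exact add_mem hx hy
  | single m k =>
    rw [mk_single]; exact Submodule.smul_mem _ _ (Submodule.subset_span ⟨m, rfl⟩)

/-! ### Paths -/

variable (K E)

/-- The element of `L_K(E)` given by a path with source `a`. -/
noncomputable def path : V → List X → LeavittPathAlgebra K E
  | a, [] => vertex K E a
  | _, e :: p => edge K E e * path (E.rng e) p

/-- The element `p*` of `L_K(E)` given by a path `p` with source `a`. -/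
noncomputable def gpath : V → List X → LeavittPathAlgebra K E
  | a, [] => vertex K E a
  | _, e :: p => gpath (E.rng e) p * ghost K E e

variable {K E}

@[simp] theorem path_nil (a : V) : path K E a [] = vertex K E a := rfl
@[simp] theorem gpath_nil (a : V) : gpath K E a [] = vertex K E a := rfl
theorem path_cons (a : V) (e : X) (p : List X) :
    path K E a (e :: p) = edge K E e * path K E (E.rng e) p := rfl
theorem gpath_cons (a : V) (e : X) (p : List X) :
    gpath K E a (e :: p) = gpath K E (E.rng e) p * ghost K E e := rfl

end LeavittPathAlgebra

/-! ### Concatenation of paths -/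

namespace DirectedGraph

variable {V : Type u} {X : Type v} {E : DirectedGraph V X}

@[simp] theorem isPath_nil {a b : V} : E.IsPath a [] b ↔ a = b := Iff.rfl
@[simp] theorem isPath_cons {a b : V} {e : X} {p : List X} :
    E.IsPath a (e :: p) b ↔ E.src e = a ∧ E.IsPath (E.rng e) p b := Iff.rfl

theorem isPath_append {a c : V} {p q : List X} :
    E.IsPath a (p ++ q) c ↔ ∃ b, E.IsPath a p b ∧ E.IsPath b q c := by
  induction p generalizing a with
  | nil => simp
  | cons e p ih => simp [ih, and_assoc]

theorem IsPath.append {a b c : V} {p q : List X} (hp : E.IsPath a p b) (hq : E.IsPath b q c) :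
    E.IsPath a (p ++ q) c := isPath_append.2 ⟨b, hp, hq⟩

theorem IsPath.target_unique {a b c : V} {p : List X} (h : E.IsPath a p b)
    (h' : E.IsPath a p c) : b = c := by
  induction p generalizing a with
  | nil => exact h.symm.trans h'
  | cons e p ih => exact ih h.2 h'.2

theorem IsPath.of_append_left {a b c : V} {p q : List X} (h : E.IsPath a (p ++ q) c)
    (hp : E.IsPath a p b) : E.IsPath b q c := by
  obtain ⟨b', hp', hq⟩ := isPath_append.1 h
  rwa [hp.target_unique hp']

theorem Reaches.refl (a : V) : E.Reaches a a := ⟨[], rfl⟩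

end DirectedGraph

/-! ### Products of paths and ghost paths -/

namespace LeavittPathAlgebra

open DirectedGraph

variable {K : Type w} [Field K] {V : Type u} {X : Type v} {E : DirectedGraph V X}
  {a b c : V} {p q : List X}

theorem vertex_mul_path (h : E.IsPath a p b) : vertex K E a * path K E a p = path K E a p := by
  cases p with
  | nil => simp
  | cons e p => rw [path_cons, ← mul_assoc, ← h.1, src_mul_edge]

theorem gpath_mul_vertex (h : E.IsPath a p b) :
    gpath K E a p * vertex K E a = gpath K E a p := by
  cases p with
  | nil => simp
  | cons e p => rw [gpath_cons, mul_assoc, ← h.1, ghost_mul_src]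

theorem path_mul_vertex (h : E.IsPath a p b) : path K E a p * vertex K E b = path K E a p := by
  induction p generalizing a with
  | nil => cases h; simp
  | cons e p ih => rw [path_cons, mul_assoc, ih h.2]

theorem vertex_mul_gpath (h : E.IsPath a p b) :
    vertex K E b * gpath K E a p = gpath K E a p := by
  induction p generalizing a with
  | nil => cases h; simp
  | cons e p ih => rw [gpath_cons, ← mul_assoc, ih h.2]

theorem vertex_mul_path_of_ne (h : E.IsPath a p b) (hc : c ≠ a) :
    vertex K E c * path K E a p = 0 := by
  rw [← vertex_mul_path h, ← mul_assoc, vertex_mul_of_ne hc, zero_mul]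

theorem gpath_mul_vertex_of_ne (h : E.IsPath a p b) (hc : c ≠ a) :
    gpath K E a p * vertex K E c = 0 := by
  rw [← gpath_mul_vertex h, mul_assoc, vertex_mul_of_ne hc.symm, mul_zero]

theorem path_append (h : E.IsPath a p b) (hq : E.IsPath b q c) :
    path K E a (p ++ q) = path K E a p * path K E b q := by
  induction p generalizing a with
  | nil => cases h; exact (vertex_mul_path hq).symm
  | cons e p ih => rw [List.cons_append, path_cons, path_cons, ih h.2, mul_assoc]

theorem gpath_append (h : E.IsPath a p b) (hq : E.IsPath b q c) :
    gpath K E a (p ++ q) = gpath K E b q * gpath K E a p := by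
  induction p generalizing a with
  | nil => cases h; exact (gpath_mul_vertex hq).symm
  | cons e p ih => rw [List.cons_append, gpath_cons, gpath_cons, ih h.2, mul_assoc]

theorem gpath_mul_path (h : E.IsPath a p b) : gpath K E a p * path K E a p = vertex K E b := by
  induction p generalizing a with
  | nil => cases h; simp
  | cons e p ih =>
    rw [gpath_cons, path_cons, mul_assoc, ← mul_assoc (ghost K E e), ghost_mul_edge,
      vertex_mul_path h.2, ih h.2]

theorem gpath_mul_path_append (h : E.IsPath a p b) (hq : E.IsPath b q c) :
    gpath K E a p * path K E a (p ++ q) = path K E b q := by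
  rw [path_append h hq, ← mul_assoc, gpath_mul_path h, vertex_mul_path hq]

/-- The paths diverge at some edge, where `e* f = 0` applies. The length bound excludes that `q` is
a proper prefix of `p`, in which case the product is a ghost path. -/
theorem gpath_mul_path_eq_zero {d : V} (hp : E.IsPath a p b) (hq : E.IsPath a q d)
    (hlen : p.length ≤ q.length) (h : ¬ p <+: q) : gpath K E a p * path K E a q = 0 := by
  induction p generalizing a q with
  | nil => simp at h
  | cons e p ih =>
    cases q with
    | nil => simp at hlen
    | cons f q =>
      rw [gpath_cons, path_cons, mul_assoc, ← mul_assoc (ghost K E e)]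
      by_cases hef : e = f
      · subst hef
        rw [ghost_mul_edge, vertex_mul_path hq.2]
        exact ih hp.2 hq.2 (by simpa using hlen) (by simpa using h)
      · rw [ghost_mul_edge_of_ne hef, zero_mul, mul_zero]

/-! ### The elements `p q*` span, and local units -/

variable (K E) in
/-- The elements `p q*` for paths `p`, `q` with the same range. -/
def monomials : Set (LeavittPathAlgebra K E) :=
  {x | ∃ a b c p q, E.IsPath a p c ∧ E.IsPath b q c ∧ x = path K E a p * gpath K E b q}

theorem vertex_mem_monomials (a : V) : vertex K E a ∈ monomials K E :=
  ⟨a, a, a, [], [], rfl, rfl, by simp⟩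

theorem gen_mul_monomial (g : LeavittGen V X) {x : LeavittPathAlgebra K E}
    (hx : x ∈ monomials K E) :
    mk K E (freeGen K g) * x = 0 ∨ mk K E (freeGen K g) * x ∈ monomials K E := by
  obtain ⟨a, b, c, p, q, hp, hq, rfl⟩ := hx
  cases g with
  | vertex d =>
    change vertex K E d * _ = 0 ∨ vertex K E d * _ ∈ _
    rw [← mul_assoc]
    by_cases hd : d = a
    · right; subst hd; rw [vertex_mul_path hp]; exact ⟨_, _, _, _, _, hp, hq, rfl⟩
    · left; rw [vertex_mul_path_of_ne hp hd, zero_mul]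
  | edge e =>
    change edge K E e * _ = 0 ∨ edge K E e * _ ∈ _
    rw [← mul_assoc]
    by_cases hd : E.rng e = a
    · right; subst hd
      exact ⟨E.src e, b, c, e :: p, q, ⟨rfl, hp⟩, hq, rfl⟩
    · left
      rw [← edge_mul_rng, mul_assoc (edge K E e), vertex_mul_path_of_ne hp hd, mul_zero, zero_mul]
  | ghost e =>
    change ghost K E e * _ = 0 ∨ ghost K E e * _ ∈ _
    cases p with
    | nil =>
      cases hp
      rw [path_nil, vertex_mul_gpath hq]
      by_cases hd : E.src e = a
      · right; subst hd
        have he : E.IsPath (E.src e) [e] (E.rng e) := ⟨rfl, rfl⟩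
        refine ⟨E.rng e, b, E.rng e, [], q ++ [e], rfl, hq.append he, ?_⟩
        rw [gpath_append hq he, path_nil, gpath_cons, gpath_nil]
        simp [← mul_assoc]
      · left
        rw [← ghost_mul_src, mul_assoc, ← vertex_mul_gpath hq, ← mul_assoc (vertex K E _),
          vertex_mul_of_ne hd, zero_mul, mul_zero]
    | cons f p =>
      rw [path_cons, ← mul_assoc, ← mul_assoc]
      by_cases hef : e = f
      · right; subst hef
        rw [ghost_mul_edge, vertex_mul_path hp.2]
        exact ⟨_, _, _, _, _, hp.2, hq, rfl⟩
      · left; rw [ghost_mul_edge_of_ne hef, zero_mul, zero_mul]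

theorem mem_span_monomials (x : LeavittPathAlgebra K E) :
    x ∈ Submodule.span K (monomials K E) := by
  suffices h : ∀ m, word K E m ∈ Submodule.span K (monomials K E) from
    Submodule.span_le.2 (by rintro _ ⟨m, rfl⟩; exact h m) (mem_span_word x)
  intro m
  induction m using word_induction with
  | of g =>
    apply Submodule.subset_span
    cases g with
    | vertex a => exact vertex_mem_monomials a
    | edge e => exact ⟨E.src e, E.rng e, E.rng e, [e], [], ⟨rfl, rfl⟩, rfl,
        (by rw [path_cons, path_nil, gpath_nil, edge_mul_rng, edge_mul_rng]; rfl)⟩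
    | ghost e => exact ⟨E.rng e, E.src e, E.rng e, [], [e], rfl, ⟨rfl, rfl⟩,
        (by rw [gpath_cons, path_nil, gpath_nil, rng_mul_ghost, rng_mul_ghost]; rfl)⟩
  | mul g m ih =>
    rw [word_mul]
    have h : Submodule.span K (monomials K E) ≤ (Submodule.span K (monomials K E)).comap
        (LinearMap.mulLeft K (mk K E (freeGen K g))) := by
      rw [Submodule.span_le]
      intro y hy
      rcases gen_mul_monomial g hy with h | h
      · simp [h]
      · exact Submodule.subset_span h
    exact h ih

theorem monomial_induction {p : LeavittPathAlgebra K E → Prop} (zero : p 0)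
    (add : ∀ x y, p x → p y → p (x + y)) (smul : ∀ (k : K) x, p x → p (k • x))
    (monomial : ∀ x ∈ monomials K E, p x) (x) : p x :=
  Submodule.span_induction (p := fun x _ => p x) monomial zero (fun x y _ _ => add x y)
    (fun k x _ => smul k x) (mem_span_monomials x)

/-- Allowing every larger `F'` lets two elements share a local unit, which the sum case needs. -/
theorem exists_local_unit (x : LeavittPathAlgebra K E) :
    ∃ F : Finset V, ∀ F', F ⊆ F' → (∑ a ∈ F', vertex K E a) * x = x ∧
      x * (∑ a ∈ F', vertex K E a) = x := by
  classical
  induction x using monomial_induction with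
  | zero => exact ⟨∅, by simp⟩
  | add x y hx hy =>
    obtain ⟨F, hF⟩ := hx
    obtain ⟨G, hG⟩ := hy
    refine ⟨F ∪ G, fun F' h => ?_⟩
    have h1 := hF F' (Finset.union_subset_left h)
    have h2 := hG F' (Finset.union_subset_right h)
    rw [mul_add, add_mul, h1.1, h1.2, h2.1, h2.2]
    exact ⟨rfl, rfl⟩
  | smul k x hx =>
    obtain ⟨F, hF⟩ := hx
    exact ⟨F, fun F' h => by rw [mul_smul_comm, smul_mul_assoc, (hF F' h).1, (hF F' h).2]; simp⟩
  | monomial x hx =>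
    obtain ⟨a, b, c, p, q, hp, hq, rfl⟩ := hx
    refine ⟨{a, b}, fun F' h => ⟨?_, ?_⟩⟩
    · rw [Finset.sum_mul, Finset.sum_eq_single a]
      · rw [← mul_assoc, vertex_mul_path hp]
      · intro d _ hd; rw [← mul_assoc, vertex_mul_path_of_ne hp hd, zero_mul]
      · intro ha; exact absurd (h (by simp)) ha
    · rw [Finset.mul_sum, Finset.sum_eq_single b]
      · rw [mul_assoc, gpath_mul_vertex hq]
      · intro d _ hd; rw [mul_assoc, gpath_mul_vertex_of_ne hq hd, mul_zero]
      · intro ha; exact absurd (h (by simp)) ha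

theorem exists_unit (x : LeavittPathAlgebra K E) :
    ∃ u : LeavittPathAlgebra K E, u * x = x ∧ x * u = x :=
  let ⟨F, hF⟩ := exists_local_unit x
  ⟨_, hF F subset_rfl⟩

/-! ### Ideals -/

variable {P : TwoSidedIdeal (LeavittPathAlgebra K E)}

/-- A ring ideal need not be a subspace a priori; a local unit `u` absorbs the scalar, as `k x = (k
u) x`. -/
theorem smul_mem (k : K) {x : LeavittPathAlgebra K E} (hx : x ∈ P) : k • x ∈ P := by
  obtain ⟨u, hu, -⟩ := exists_unit x
  rw [← hu, ← smul_mul_assoc]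
  exact P.mul_mem_left _ _ hx

theorem smul_mem_iff {k : K} (hk : k ≠ 0) {x : LeavittPathAlgebra K E} : k • x ∈ P ↔ x ∈ P :=
  ⟨fun h => by simpa [smul_smul, inv_mul_cancel₀ hk] using smul_mem k⁻¹ h, smul_mem k⟩

theorem exists_vertex_mul_notMem {x : LeavittPathAlgebra K E} (hx : x ∉ P) :
    ∃ a, vertex K E a * x ∉ P := by
  by_contra! h
  obtain ⟨F, hF⟩ := exists_local_unit x
  apply hx
  rw [← (hF F subset_rfl).1, Finset.sum_mul]
  exact sum_mem fun a _ => h a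

theorem exists_mul_vertex_notMem {x : LeavittPathAlgebra K E} (hx : x ∉ P) :
    ∃ a, x * vertex K E a ∉ P := by
  by_contra! h
  obtain ⟨F, hF⟩ := exists_local_unit x
  apply hx
  rw [← (hF F subset_rfl).2, Finset.mul_sum]
  exact sum_mem fun a _ => h a

theorem mem_of_isPath (h : E.IsPath a p b) (ha : vertex K E a ∈ P) : vertex K E b ∈ P := by
  rw [← gpath_mul_path h, ← vertex_mul_path h]
  exact P.mul_mem_left _ _ (P.mul_mem_right _ _ ha)

theorem path_mem_iff (h : E.IsPath a p b) : path K E a p ∈ P ↔ vertex K E b ∈ P := by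
  refine ⟨fun hp => ?_, fun hb => ?_⟩
  · rw [← gpath_mul_path h]; exact P.mul_mem_left _ _ hp
  · rw [← path_mul_vertex h]; exact P.mul_mem_left _ _ hb

theorem gpath_mem_iff (h : E.IsPath a p b) : gpath K E a p ∈ P ↔ vertex K E b ∈ P := by
  refine ⟨fun hp => ?_, fun hb => ?_⟩
  · rw [← gpath_mul_path h]; exact P.mul_mem_right _ _ hp
  · rw [← vertex_mul_gpath h]; exact P.mul_mem_right _ _ hb

theorem exists_edge_notMem (hE : E.RowFinite) (ha : vertex K E a ∉ P)
    (hne : (E.src ⁻¹' {a}).Nonempty) : ∃ e, E.src e = a ∧ vertex K E (E.rng e) ∉ P := by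
  by_contra! h
  apply ha
  rw [vertex_eq_sum (hE a) hne]
  refine sum_mem fun e he => ?_
  rw [← edge_mul_rng]
  exact P.mul_mem_right _ _ (P.mul_mem_left _ _ (h e (by simpa using he)))

end LeavittPathAlgebra

/-! ### Prime ideals and their maximal tails -/

/-- Elementwise form of primeness, for rings in which every element has a right unit. -/
theorem IsPrimeTwoSided.exists_mul_mul_notMem {A : Type u} [NonUnitalRing A]
    (hA : ∀ x : A, ∃ u, x * u = x) {P : TwoSidedIdeal A}
    (hP : IsPrimeTwoSided P) {x y : A} (hx : x ∉ P) (hy : y ∉ P) : ∃ r, x * r * y ∉ P := by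
  by_contra! h
  -- `I` is the set of `x` with `x A y ⊆ P`, and `J` the set of `z` with `I A z ⊆ P`. Right units
  -- give `I J ⊆ P`, and under the negated claim the given elements lie in `I` and `J`.
  let I : TwoSidedIdeal A := .mk' {x | ∀ r, x * r * y ∈ P} (by simp [P.zero_mem])
    (fun h h' r => by rw [add_mul, add_mul]; exact P.add_mem (h r) (h' r))
    (fun h r => by rw [neg_mul, neg_mul]; exact P.neg_mem (h r))
    (fun h r => by rw [mul_assoc, mul_assoc]; exact P.mul_mem_left _ _ (by simpa [mul_assoc] using h r))
    (fun {x z} h r => by simpa [mul_assoc] using h (z * r))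
  have hI : ∀ z, z ∈ I ↔ ∀ r, z * r * y ∈ P := fun z => by
    simp only [I, TwoSidedIdeal.mem_mk']; rfl
  let J : TwoSidedIdeal A := .mk' {z | ∀ t ∈ I, ∀ r, t * r * z ∈ P} (by simp [P.zero_mem])
    (fun h h' t ht r => by rw [mul_add]; exact P.add_mem (h t ht r) (h' t ht r))
    (fun h t ht r => by rw [mul_neg]; exact P.neg_mem (h t ht r))
    (fun {x z} h t ht r => by simpa [mul_assoc] using h t ht (r * x))
    (fun h t ht r => by rw [← mul_assoc]; exact P.mul_mem_right _ _ (h t ht r))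
  have hJ : ∀ z, z ∈ J ↔ ∀ t ∈ I, ∀ r, t * r * z ∈ P := fun z => by
    simp only [J, TwoSidedIdeal.mem_mk']; rfl
  rcases hP.2 I J fun z hz t ht => by
    obtain ⟨u, hu⟩ := hA z
    simpa [hu] using (hJ t).1 ht z hz u with h1 | h1
  · exact hx (h1 ((hI x).2 h))
  · exact hy (h1 ((hJ y).2 fun t ht r => (hI t).1 ht r))

namespace LeavittPathAlgebra

variable {K : Type w} [Field K] {V : Type u} {X : Type v} {E : DirectedGraph V X}
  {P : TwoSidedIdeal (LeavittPathAlgebra K E)}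

theorem exists_mul_mul_notMem (hP : IsPrimeTwoSided P) {x y : LeavittPathAlgebra K E}
    (hx : x ∉ P) (hy : y ∉ P) : ∃ r, x * r * y ∉ P :=
  hP.exists_mul_mul_notMem (fun x => (exists_unit x).imp fun _ h => h.2) hx hy

theorem isMaximalTail_verticesOutside (hE : E.RowFinite) (hP : IsPrimeTwoSided P) :
    E.IsMaximalTail (verticesOutside P) where
  nonempty := by
    by_contra h
    rw [Set.not_nonempty_iff_eq_empty] at h
    have h' : ∀ a, vertex K E a ∈ P := fun a => by
      by_contra ha
      exact (h ▸ (show a ∈ verticesOutside P from ha) : a ∈ (∅ : Set V))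
    refine hP.1 (TwoSidedIdeal.ext fun x => ⟨fun _ => trivial, fun _ => ?_⟩)
    by_contra hx
    obtain ⟨a, ha⟩ := exists_vertex_mul_notMem hx
    exact ha (P.mul_mem_right _ _ (h' a))
  mem_of_reaches a b hb := fun ⟨p, hp⟩ ha => hb (mem_of_isPath hp ha)
  exists_edge a ha hne := exists_edge_notMem hE ha hne
  directed a ha b hb := by
    -- Some monomial `p q*` of `r` must survive between `a` and `b`; the common range of `p` and `q`
    -- is then a lower bound outside `P`.
    obtain ⟨r, hr⟩ := exists_mul_mul_notMem hP ha hb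
    contrapose! hr
    induction r using monomial_induction with
    | zero => simp [P.zero_mem]
    | add x y hx hy => rw [mul_add, add_mul]; exact P.add_mem hx hy
    | smul k x hx => rw [mul_smul_comm, smul_mul_assoc]; exact smul_mem k hx
    | monomial x hx =>
      obtain ⟨a', b', c, p, q, hp, hq, rfl⟩ := hx
      rw [← mul_assoc, mul_assoc (_ * _)]
      by_cases h1 : a = a'
      · by_cases h2 : b = b'
        · subst h1 h2
          by_contra hn
          refine hr c (fun hc => hn ?_) ⟨p, hp⟩ ⟨q, hq⟩
          exact P.mul_mem_right _ _ (P.mul_mem_left _ _ ((path_mem_iff hp).2 hc))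
        · rw [gpath_mul_vertex_of_ne hq h2, mul_zero]; exact P.zero_mem
      · rw [vertex_mul_path_of_ne hp h1, zero_mul]; exact P.zero_mem

end LeavittPathAlgebra
namespace LeavittPathAlgebra

/-! ### Homogeneous components -/

section Grading

variable {K : Type w} [Field K] {V : Type u} {X : Type v} {E : DirectedGraph V X}

variable (K E) in
/-- The homogeneous component of degree `n` of an element of the free algebra, in `L_K(E)`. -/
noncomputable def freeProj (n : ℤ) : FreeLeavitt K V X →ₗ[K] LeavittPathAlgebra K E :=
  open Classical in
  Finsupp.linearCombination K
    (fun m => if wordWeight m = Multiplicative.ofAdd n then word K E m else 0) ∘ₗ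
  (MonoidAlgebra.coeffLinearEquiv K).toLinearMap

open Classical in
theorem freeProj_single (n : ℤ) (m : FreeSemigroup (LeavittGen V X)) (k : K) :
    freeProj K E n (MonoidAlgebra.single m k) =
      if wordWeight m = Multiplicative.ofAdd n then k • word K E m else 0 := by
  simp [freeProj, MonoidAlgebra.coeffLinearEquiv]

theorem freeProj_single_mul (n : ℤ) (m : FreeSemigroup (LeavittGen V X)) (k : K)
    (x : FreeLeavitt K V X) :
    freeProj K E n (MonoidAlgebra.single m k * x) =
      k • (word K E m * freeProj K E (n - (wordWeight m).toAdd) x) := by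
  induction x using MonoidAlgebra.induction_linear with
  | zero => simp
  | add x y hx hy => rw [mul_add, map_add, map_add, hx, hy, mul_add, smul_add]
  | single m' k' =>
    rw [MonoidAlgebra.single_mul_single, freeProj_single, freeProj_single, map_mul]
    have : wordWeight m * wordWeight m' = Multiplicative.ofAdd n ↔
        wordWeight m' = Multiplicative.ofAdd (n - (wordWeight m).toAdd) := by
      rw [← Multiplicative.toAdd.injective.eq_iff, ← Multiplicative.toAdd.injective.eq_iff]
      simp only [toAdd_mul, toAdd_ofAdd]
      omega
    simp only [this, word_mul]
    split_ifs <;> simp [mul_smul, mul_smul_comm]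

theorem freeProj_mul_single (n : ℤ) (m : FreeSemigroup (LeavittGen V X)) (k : K)
    (x : FreeLeavitt K V X) :
    freeProj K E n (x * MonoidAlgebra.single m k) =
      k • (freeProj K E (n - (wordWeight m).toAdd) x * word K E m) := by
  induction x using MonoidAlgebra.induction_linear with
  | zero => simp
  | add x y hx hy => rw [add_mul, map_add, map_add, hx, hy, add_mul, smul_add]
  | single m' k' =>
    rw [MonoidAlgebra.single_mul_single, freeProj_single, freeProj_single, map_mul]
    have : wordWeight m' * wordWeight m = Multiplicative.ofAdd n ↔
        wordWeight m' = Multiplicative.ofAdd (n - (wordWeight m).toAdd) := by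
      rw [← Multiplicative.toAdd.injective.eq_iff, ← Multiplicative.toAdd.injective.eq_iff]
      simp only [toAdd_mul, toAdd_ofAdd]
      omega
    simp only [this, word_mul]
    split_ifs <;> simp [mul_smul, smul_mul_assoc, smul_comm k]

theorem freeProj_gen (n : ℤ) (g : LeavittGen V X) :
    freeProj K E n (freeGen K g) = if g.weight = n then mk K E (freeGen K g) else 0 := by
  rw [freeGen, freeProj_single]
  simp [wordWeight, word]

theorem freeProj_gen_mul_gen (n : ℤ) (g h : LeavittGen V X) :
    freeProj K E n (freeGen K g * freeGen K h) =
      if g.weight + h.weight = n then mk K E (freeGen K g * freeGen K h) else 0 := by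
  rw [freeGen, freeGen, MonoidAlgebra.single_mul_single, freeProj_single]
  simp only [wordWeight, map_mul, FreeSemigroup.lift_of, ← ofAdd_add, mul_one, one_smul, word,
    Multiplicative.ofAdd.injective.eq_iff]

theorem weight_vertex (a : V) : (LeavittGen.vertex (X := X) a).weight = 0 := by
  simp [LeavittGen.weight]

theorem weight_edge (e : X) : (LeavittGen.edge (V := V) e).weight = 1 := by
  simp [LeavittGen.weight]

theorem weight_ghost (e : X) : (LeavittGen.ghost (V := V) e).weight = -1 := by
  simp [LeavittGen.weight]

/-- Each relation is homogeneous: both sides have the same weight, or one side is zero. -/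
theorem freeProj_eq_of_rel {x y : FreeLeavitt K V X} (h : LeavittRel K E x y) (n : ℤ) :
    freeProj K E n x = freeProj K E n y := by
  have hmk := mk_eq_of_rel h
  cases h <;>
    simp only [map_zero, map_sum, freeProj_gen, freeProj_gen_mul_gen, weight_vertex,
      weight_edge, weight_ghost, add_zero, zero_add, add_neg_cancel, neg_add_cancel] <;>
    simp only [hmk, map_zero, ite_self]
  split_ifs <;> simp

theorem freeProj_eq_of_leavittCon {x y : FreeLeavitt K V X} (h : leavittCon K E x y) (n : ℤ) :
    freeProj K E n x = freeProj K E n y := by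
  change RingConGen.Rel _ x y at h
  induction h generalizing n with
  | of x y h =>
    obtain ⟨k, x', y', h, rfl, rfl⟩ := h
    rw [map_smul, map_smul, freeProj_eq_of_rel h]
  | refl x => rfl
  | symm _ ih => exact (ih n).symm
  | trans _ _ ih₁ ih₂ => exact (ih₁ n).trans (ih₂ n)
  | add _ _ ih₁ ih₂ => rw [map_add, map_add, ih₁, ih₂]
  | @mul x x' y y' hxx hyy ih₁ ih₂ =>
    -- Only one factor changes at a time; the fixed factor may then be taken to be a word, which
    -- merely shifts the degree.
    trans freeProj K E n (x * y')
    · clear ih₁ hxx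
      induction x using MonoidAlgebra.induction_linear with
      | zero => simp
      | add x z hx hz => rw [add_mul, add_mul, map_add, map_add, hx, hz]
      | single m k => rw [freeProj_single_mul, freeProj_single_mul, ih₂]
    · clear ih₂ hyy
      induction y' using MonoidAlgebra.induction_linear with
      | zero => simp
      | add x z hx hz => rw [mul_add, mul_add, map_add, map_add, hx, hz]
      | single m k => rw [freeProj_mul_single, freeProj_mul_single, ih₁]

variable (K E) in
/-- The projection of `L_K(E)` to its homogeneous component of degree `n`. -/
noncomputable def proj (n : ℤ) : LeavittPathAlgebra K E →ₗ[K] LeavittPathAlgebra K E where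
  toFun := Quotient.lift (freeProj K E n) fun _ _ h => freeProj_eq_of_leavittCon h n
  map_add' x y := by
    obtain ⟨x, rfl⟩ := mk_surjective K E x
    obtain ⟨y, rfl⟩ := mk_surjective K E y
    rw [← map_add]
    exact map_add (freeProj K E n) x y
  map_smul' k x := by
    obtain ⟨x, rfl⟩ := mk_surjective K E x
    rw [← mk_smul]
    exact map_smul (freeProj K E n) k x

theorem proj_mk (n : ℤ) (x : FreeLeavitt K V X) : proj K E n (mk K E x) = freeProj K E n x := rfl

theorem proj_word_mul (n : ℤ) (m : FreeSemigroup (LeavittGen V X)) (x : LeavittPathAlgebra K E) :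
    proj K E n (word K E m * x) = word K E m * proj K E (n - (wordWeight m).toAdd) x := by
  obtain ⟨x, rfl⟩ := mk_surjective K E x
  rw [word, ← map_mul, proj_mk, proj_mk, freeProj_single_mul, one_smul, word]

theorem proj_mul_word (n : ℤ) (m : FreeSemigroup (LeavittGen V X)) (x : LeavittPathAlgebra K E) :
    proj K E n (x * word K E m) = proj K E (n - (wordWeight m).toAdd) x * word K E m := by
  obtain ⟨x, rfl⟩ := mk_surjective K E x
  rw [word, ← map_mul, proj_mk, proj_mk, freeProj_mul_single, one_smul, word]

theorem proj_vertex (n : ℤ) (a : V) :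
    proj K E n (vertex K E a) = if n = 0 then vertex K E a else 0 := by
  rw [vertex, proj_mk, freeProj_gen]; simp [LeavittGen.weight, eq_comm]

theorem proj_of_mem_component {n : ℤ} (m : ℤ) {x : LeavittPathAlgebra K E}
    (hx : x ∈ component K E n) : proj K E m x = if m = n then x else 0 := by
  induction hx using Submodule.span_induction with
  | mem x hx =>
    obtain ⟨t, ht, rfl⟩ := hx
    rw [proj_mk, freeProj_single, ht, one_smul]
    simp [eq_comm, word]
  | zero => simp
  | add x y _ _ hx hy => rw [map_add, hx, hy]; split_ifs <;> simp
  | smul k x _ hx => rw [map_smul, hx]; split_ifs <;> simp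

theorem proj_path_mul (n : ℤ) (a : V) (p : List X) (x : LeavittPathAlgebra K E) :
    proj K E n (path K E a p * x) = path K E a p * proj K E (n - p.length) x := by
  induction p generalizing a n with
  | nil =>
    have := proj_word_mul (K := K) (E := E) n (.of (.vertex a)) x
    simp only [wordWeight, LeavittGen.weight, FreeSemigroup.lift_of, toAdd_ofAdd] at this
    rw [List.length_nil, Nat.cast_zero]
    exact this
  | cons e p ih =>
    have := proj_word_mul (K := K) (E := E) n (.of (.edge e)) (path K E (E.rng e) p * x)
    simp only [wordWeight, LeavittGen.weight, FreeSemigroup.lift_of, toAdd_ofAdd] at this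
    rw [ih] at this
    rw [path_cons, mul_assoc, mul_assoc]
    refine this.trans ?_
    rw [List.length_cons, Nat.cast_succ, sub_sub, add_comm (1 : ℤ)]
    rfl

theorem proj_path {n : ℤ} {a b : V} {p : List X} (hp : E.IsPath a p b) :
    proj K E n (path K E a p) = if n = p.length then path K E a p else 0 := by
  rw [← path_mul_vertex hp, proj_path_mul, proj_vertex]
  simp only [sub_eq_zero]
  split_ifs <;> simp

variable (K E) in
theorem exists_eq_sum_proj (x : LeavittPathAlgebra K E) :
    ∃ c : ℤ →₀ LeavittPathAlgebra K E,
      (∀ n, c n = proj K E n x ∧ c n ∈ component K E n) ∧ x = c.sum fun _ y => y := by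
  classical
  induction mem_span_word x using Submodule.span_induction with
  | mem x hx =>
    obtain ⟨m, rfl⟩ := hx
    have hm : word K E m ∈ component K E (wordWeight m).toAdd :=
      Submodule.subset_span ⟨m, rfl, rfl⟩
    refine ⟨Finsupp.single (wordWeight m).toAdd (word K E m), fun n => ⟨?_, ?_⟩, by simp⟩
    · rw [proj_of_mem_component n hm, Finsupp.single_apply]; simp [eq_comm]
    · rw [Finsupp.single_apply]; split_ifs with h
      · exact h ▸ hm
      · exact zero_mem _
  | zero => exact ⟨0, by simp⟩
  | add x y _ _ hx hy =>
    obtain ⟨c, hc, hc'⟩ := hx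
    obtain ⟨d, hd, hd'⟩ := hy
    refine ⟨c + d, fun n => ⟨?_, ?_⟩, ?_⟩
    · rw [Finsupp.add_apply, map_add, (hc n).1, (hd n).1]
    · exact add_mem (hc n).2 (hd n).2
    · rw [Finsupp.sum_add_index' (fun _ => rfl) (fun _ _ _ => rfl), ← hc', ← hd']
  | smul k x _ hx =>
    obtain ⟨c, hc, hc'⟩ := hx
    refine ⟨k • c, fun n => ⟨?_, ?_⟩, ?_⟩
    · rw [Finsupp.smul_apply, map_smul, (hc n).1]
    · exact Submodule.smul_mem _ _ (hc n).2
    · rw [Finsupp.sum_smul_index' (fun _ => rfl), ← Finsupp.smul_sum, ← hc']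

variable {P : TwoSidedIdeal (LeavittPathAlgebra K E)}

theorem isGradedIdeal_iff : IsGradedIdeal P ↔ ∀ x ∈ P, ∀ n, proj K E n x ∈ P := by
  refine ⟨fun h x hx n => ?_, fun h x hx => ?_⟩
  · obtain ⟨c, hc, rfl⟩ := h x hx
    rw [Finsupp.sum, map_sum]
    refine sum_mem fun m _ => ?_
    rw [proj_of_mem_component n (hc m).1]
    split_ifs
    · exact (hc m).2
    · exact P.zero_mem
  · obtain ⟨c, hc, hx'⟩ := exists_eq_sum_proj K E x
    exact ⟨c, fun n => ⟨(hc n).2, (hc n).1 ▸ h x hx n⟩, hx'⟩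

variable (P) in
/-- The largest graded ideal in `P`. -/
noncomputable def gradedPart : TwoSidedIdeal (LeavittPathAlgebra K E) :=
  .mk' {x | ∀ n, proj K E n x ∈ P} (fun n => by simp [P.zero_mem])
    (fun hx hy n => by rw [map_add]; exact P.add_mem (hx n) (hy n))
    (fun hx n => by rw [map_neg]; exact P.neg_mem (hx n))
    (fun {x y} hy n => by
      induction mem_span_word x using Submodule.span_induction generalizing n with
      | mem x hx => obtain ⟨m, rfl⟩ := hx; rw [proj_word_mul]; exact P.mul_mem_left _ _ (hy _)
      | zero => simp [P.zero_mem]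
      | add x z _ _ hx hz => rw [add_mul, map_add]; exact P.add_mem (hx n) (hz n)
      | smul k x _ hx => rw [smul_mul_assoc, map_smul]; exact smul_mem _ (hx n))
    (fun {y x} hy n => by
      induction mem_span_word x using Submodule.span_induction generalizing n with
      | mem x hx => obtain ⟨m, rfl⟩ := hx; rw [proj_mul_word]; exact P.mul_mem_right _ _ (hy _)
      | zero => simp [P.zero_mem]
      | add x z _ _ hx hz => rw [mul_add, map_add]; exact P.add_mem (hx n) (hz n)
      | smul k x _ hx => rw [mul_smul_comm, map_smul]; exact smul_mem _ (hx n))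

theorem mem_gradedPart {x : LeavittPathAlgebra K E} :
    x ∈ gradedPart P ↔ ∀ n, proj K E n x ∈ P := by
  simp only [gradedPart, TwoSidedIdeal.mem_mk']; rfl

theorem vertex_mem_gradedPart {a : V} : vertex K E a ∈ gradedPart P ↔ vertex K E a ∈ P := by
  rw [mem_gradedPart]
  refine ⟨fun h => by simpa [proj_vertex] using h 0, fun h n => ?_⟩
  rw [proj_vertex]
  split_ifs
  exacts [h, P.zero_mem]

end Grading

end LeavittPathAlgebra

/-! ### A criterion for primitivity -/

/-- Extend `R` to a right ideal `N` maximal among those without `e`. Then `A / N` is simple, and its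
annihilator contains `P`. Were it larger, `hQ` would give `q` in it with `e - q ∈ R`; since `e * q ∈
N` forces `q ∈ N`, this would put `e` in `N`. -/
theorem isPrimitiveIdeal_of_rightIdeal {A : Type u} [NonUnitalRing A] {P : TwoSidedIdeal A}
    {e : A} (he : e * e = e) (R : AddSubgroup A) (hR : ∀ x ∈ R, ∀ a, x * a ∈ R)
    (hPR : ∀ x ∈ P, x ∈ R) (heR : e ∉ R) (hmod : ∀ a, a - e * a ∈ R)
    (hQ : ∀ Q : TwoSidedIdeal A, P ≤ Q → ¬ Q ≤ P → ∃ q ∈ Q, e - q ∈ R) :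
    IsPrimitiveIdeal P := by
  obtain ⟨N, hRN, hN⟩ := zorn_le_nonempty₀
    {N : AddSubgroup A | (∀ x ∈ N, ∀ a, x * a ∈ N) ∧ e ∉ N} (fun c hc hchain N hNc => by
      have hdir := hchain.directedOn
      refine ⟨sSup c, ⟨fun x hx a => ?_, fun h => ?_⟩, fun z hz => le_sSup hz⟩
      · rw [AddSubgroup.mem_sSup_of_directedOn ⟨N, hNc⟩ hdir] at hx ⊢
        obtain ⟨t, ht, hxt⟩ := hx
        exact ⟨t, ht, (hc ht).1 x hxt a⟩
      · rw [AddSubgroup.mem_sSup_of_directedOn ⟨N, hNc⟩ hdir] at h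
        obtain ⟨t, ht, hxt⟩ := h
        exact (hc ht).2 hxt) R ⟨hR, heR⟩
  obtain ⟨⟨hNr, heN⟩, hmax⟩ := hN
  have hmem : ∀ a, e * a ∈ N ↔ a ∈ N := fun a => by
    constructor
    · intro h; simpa using add_mem (hRN (hmod a)) h
    · intro h; simpa using sub_mem h (hRN (hmod a))
  let ρ : Aᵐᵒᵖ →ₙ+* AddMonoid.End (A ⧸ N) :=
    { toFun := fun a => QuotientAddGroup.map N N (AddMonoidHom.mulRight a.unop)
        fun x hx => hNr x hx _
      map_zero' := by
        ext x
        obtain ⟨x, rfl⟩ := QuotientAddGroup.mk_surjective x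
        exact congrArg (fun t : A => (t : A ⧸ N)) (mul_zero x)
      map_add' := fun a b => by
        ext x
        obtain ⟨x, rfl⟩ := QuotientAddGroup.mk_surjective x
        exact congrArg (fun t : A => (t : A ⧸ N)) (mul_add x a.unop b.unop)
      map_mul' := fun a b => by
        ext x
        obtain ⟨x, rfl⟩ := QuotientAddGroup.mk_surjective x
        exact congrArg (fun t : A => (t : A ⧸ N)) (mul_assoc x b.unop a.unop).symm }
  have hρ : ∀ a x : A, ρ (.op a) (x : A ⧸ N) = ((x * a : A) : A ⧸ N) := fun a x => rfl
  refine ⟨A ⧸ N, inferInstance, ρ, ⟨⟨e, (e : A ⧸ N), ?_⟩, fun T hT => ?_⟩, ?_⟩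
  · rw [hρ, he, Ne, QuotientAddGroup.eq_zero_iff]
    exact heN
  -- The class of `e` generates the quotient because `x` and `e * x` agree modulo `R`. If it is not
  -- in `T`, the preimage of `T` competes with `N` in the maximality.
  · by_cases h : (e : A ⧸ N) ∈ T
    · right
      rw [eq_top_iff]
      rintro x -
      obtain ⟨x, rfl⟩ := QuotientAddGroup.mk_surjective x
      have h1 := hT x _ h
      rw [hρ] at h1
      have : ((x : A) : A ⧸ N) = ((e * x : A) : A ⧸ N) := by
        rw [← sub_eq_zero, ← QuotientAddGroup.mk_sub, QuotientAddGroup.eq_zero_iff]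
        exact hRN (hmod x)
      rwa [this]
    · left
      rw [eq_bot_iff]
      intro x hx
      obtain ⟨x, rfl⟩ := QuotientAddGroup.mk_surjective x
      rw [AddSubgroup.mem_bot, QuotientAddGroup.eq_zero_iff]
      refine hmax (y := T.comap (QuotientAddGroup.mk' N)) ⟨fun y hy a => hT a _ hy, h⟩
        (fun y hy => ?_) hx
      have : (QuotientAddGroup.mk' N) y = 0 := (QuotientAddGroup.eq_zero_iff y).2 hy
      rw [AddSubgroup.mem_comap, this]
      exact T.zero_mem
  -- `Q` is the annihilator of `A ⧸ N`.
  · let Q : TwoSidedIdeal A := .mk' {a | ∀ x, x * a ∈ N} (by simp [N.zero_mem])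
      (fun h h' x => by rw [mul_add]; exact N.add_mem (h x) (h' x))
      (fun h x => by rw [mul_neg]; exact N.neg_mem (h x))
      (fun {x y} h z => by rw [← mul_assoc]; exact h _)
      (fun {x y} h z => by rw [← mul_assoc]; exact hNr _ (h z) _)
    have hmQ : ∀ a, a ∈ Q ↔ ∀ x, x * a ∈ N := fun a => by
      simp only [Q, TwoSidedIdeal.mem_mk']; rfl
    have hPQ : P ≤ Q := fun a ha => (hmQ a).2 fun x => hRN (hPR _ (P.mul_mem_left _ _ ha))
    have hQP : Q ≤ P := by
      by_contra h
      obtain ⟨q, hq, hqR⟩ := hQ Q hPQ h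
      exact heN (by simpa using add_mem (hRN hqR) ((hmem q).1 ((hmQ q).1 hq e)))
    intro a
    rw [le_antisymm hPQ hQP, hmQ]
    constructor
    · intro h
      ext x
      obtain ⟨x, rfl⟩ := QuotientAddGroup.mk_surjective x
      exact (QuotientAddGroup.eq_zero_iff _).2 (h x)
    · intro h x
      have := DFunLike.congr_fun h (x : A ⧸ N)
      rw [hρ] at this
      exact (QuotientAddGroup.eq_zero_iff _).1 this

/-! ### Closed paths and the cycles inside them -/

namespace DirectedGraph

variable {V : Type u} {X : Type v} (E : DirectedGraph V X)

/-- A path of positive length from `a` to `a`. -/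
def IsClosedPath (a : V) (t : List X) : Prop := t ≠ [] ∧ E.IsPath a t a

variable {E}

/-- The sources of all edges of a path reach its range. -/
theorem IsPath.reaches_of_mem {a b : V} {p : List X} (h : E.IsPath a p b) {e : X} (he : e ∈ p) :
    E.Reaches (E.src e) b ∧ E.Reaches (E.rng e) b := by
  induction p generalizing a with
  | nil => simp at he
  | cons f p ih =>
    rcases List.mem_cons.1 he with rfl | he
    · exact ⟨⟨e :: p, rfl, h.2⟩, ⟨p, h.2⟩⟩
    · exact ih h.2 he

theorem exists_append_of_not_nodup_map {α : Type*} {f : X → α} {t : List X}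
    (h : ¬ (t.map f).Nodup) :
    ∃ t₁ x t₂ y t₃, t = t₁ ++ (x :: t₂ ++ y :: t₃) ∧ f x = f y := by
  induction t with
  | nil => simp at h
  | cons x t ih =>
    by_cases hx : f x ∈ t.map f
    · obtain ⟨y, hy, hxy⟩ := List.mem_map.1 hx
      obtain ⟨t₂, t₃, rfl⟩ := List.append_of_mem hy
      exact ⟨[], x, t₂, y, t₃, rfl, hxy.symm⟩
    · obtain ⟨t₁, y, t₂, z, t₃, rfl, hyz⟩ := ih fun h' => h (List.nodup_cons.2 ⟨hx, h'⟩)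
      exact ⟨x :: t₁, y, t₂, z, t₃, rfl, hyz⟩

/-- Every closed path contains a cycle. -/
theorem exists_isCycle_subset (n : ℕ) {a : V} {t : List X} (ht : E.IsClosedPath a t)
    (hn : t.length = n) : ∃ c, E.IsCycle c ∧ c ⊆ t := by
  induction n using Nat.strong_induction_on generalizing a t with
  | _ n ih =>
  by_cases hd : (t.map E.src).Nodup
  · exact ⟨t, ⟨ht.1, ⟨a, ht.2⟩, hd⟩, List.Subset.refl _⟩
  -- The segment `e :: t₂` between two edges with the same source is a shorter closed path.
  · obtain ⟨t₁, e, t₂, f, t₃, rfl, hef⟩ := exists_append_of_not_nodup_map hd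
    obtain ⟨b, -, hb⟩ := isPath_append.1 ht.2
    obtain ⟨d, hd, hf⟩ := isPath_append (p := e :: t₂).1 hb
    obtain ⟨c, hc, hct⟩ := ih _ (by simp at hn; simp; omega)
      (show E.IsClosedPath b (e :: t₂) from ⟨by simp, by rwa [← hf.1, ← hef, hd.1] at hd⟩) rfl
    refine ⟨c, hc, fun x hx => ?_⟩
    have := hct hx
    simp only [List.mem_append, List.mem_cons] at this ⊢
    tauto

end DirectedGraph

namespace LeavittPathAlgebra
open DirectedGraph

variable {K : Type w} [Field K] {V : Type u} {X : Type v} {E : DirectedGraph V X}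
  {P : TwoSidedIdeal (LeavittPathAlgebra K E)} {a b c : V} {p q : List X}

/-! ### Reduction of an element to a vertex plus closed paths -/

variable (K E) in
/-- The span of the elements `p q*` with `p` starting at `a`, `q` at `b`, and `q` of length at
most `n`. -/
noncomputable def ghostDegreeLE (n : ℕ) (a b : V) : Submodule K (LeavittPathAlgebra K E) :=
  Submodule.span K {x | ∃ c p q, E.IsPath a p c ∧ E.IsPath b q c ∧ q.length ≤ n ∧
    x = path K E a p * gpath K E b q}

theorem ghostDegreeLE_mono {m n : ℕ} (h : m ≤ n) (a b : V) :
    ghostDegreeLE K E m a b ≤ ghostDegreeLE K E n a b :=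
  Submodule.span_mono fun _ ⟨c, p, q, hp, hq, hl, hx⟩ => ⟨c, p, q, hp, hq, hl.trans h, hx⟩

theorem exists_mem_ghostDegreeLE (a b : V) (x : LeavittPathAlgebra K E) :
    ∃ n, vertex K E a * x * vertex K E b ∈ ghostDegreeLE K E n a b := by
  induction x using monomial_induction with
  | zero => exact ⟨0, by simp⟩
  | add x y hx hy =>
    obtain ⟨m, hm⟩ := hx
    obtain ⟨n, hn⟩ := hy
    refine ⟨max m n, ?_⟩
    rw [mul_add, add_mul]
    exact add_mem (ghostDegreeLE_mono (le_max_left ..) _ _ hm)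
      (ghostDegreeLE_mono (le_max_right ..) _ _ hn)
  | smul k x hx =>
    obtain ⟨m, hm⟩ := hx
    exact ⟨m, by rw [mul_smul_comm, smul_mul_assoc]; exact Submodule.smul_mem _ _ hm⟩
  | monomial x hx =>
    obtain ⟨a', b', c, p, q, hp, hq, rfl⟩ := hx
    refine ⟨q.length, ?_⟩
    rw [← mul_assoc, mul_assoc (_ * _)]
    by_cases h1 : a = a'
    · by_cases h2 : b = b'
      · subst h1 h2
        rw [vertex_mul_path hp, gpath_mul_vertex hq]
        exact Submodule.subset_span ⟨c, p, q, hp, hq, le_rfl, rfl⟩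
      · rw [gpath_mul_vertex_of_ne hq h2, mul_zero]; exact zero_mem _
    · rw [vertex_mul_path_of_ne hp h1, zero_mul]; exact zero_mem _

theorem mul_edge_mem_ghostDegreeLE {n : ℕ} {e : X} {y : LeavittPathAlgebra K E}
    (hy : y ∈ ghostDegreeLE K E (n + 1) a (E.src e)) :
    y * edge K E e ∈ ghostDegreeLE K E n a (E.rng e) := by
  suffices h : ghostDegreeLE K E (n + 1) a (E.src e) ≤ (ghostDegreeLE K E n a (E.rng e)).comap
      (LinearMap.mulRight K (edge K E e)) from h hy
  rw [ghostDegreeLE, Submodule.span_le]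
  rintro _ ⟨c, p, q, hp, hq, hl, rfl⟩
  change path K E a p * gpath K E (E.src e) q * edge K E e ∈ ghostDegreeLE K E n a (E.rng e)
  cases q with
  | nil =>
    cases hq
    have he : E.IsPath (E.src e) [e] (E.rng e) := ⟨rfl, rfl⟩
    refine Submodule.subset_span ⟨_, p ++ [e], [], hp.append he, rfl, Nat.zero_le _, ?_⟩
    rw [path_append hp he, path_cons, path_nil, gpath_nil, gpath_nil, path_mul_vertex hp,
      edge_mul_rng, mul_assoc, edge_mul_rng]
  | cons f q =>
    rw [gpath_cons, mul_assoc, mul_assoc]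
    by_cases hef : f = e
    · subst hef
      rw [ghost_mul_edge, gpath_mul_vertex hq.2]
      exact Submodule.subset_span ⟨c, p, q, hp, hq.2, by simpa using hl, rfl⟩
    · rw [ghost_mul_edge_of_ne hef, mul_zero, mul_zero]; exact zero_mem _

theorem ghostDegreeLE_le_zero_of_sink {n : ℕ} (hb : ¬ (E.src ⁻¹' {b}).Nonempty) :
    ghostDegreeLE K E n a b ≤ ghostDegreeLE K E 0 a b := by
  refine Submodule.span_mono ?_
  rintro _ ⟨c, p, q, hp, hq, -, rfl⟩
  cases q with
  | nil => exact ⟨c, p, [], hp, hq, le_rfl, rfl⟩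
  | cons f q => exact absurd ⟨f, hq.1⟩ hb

theorem mul_vertex_of_mem_ghostDegreeLE {n : ℕ} {y : LeavittPathAlgebra K E}
    (hy : y ∈ ghostDegreeLE K E n a b) : y * vertex K E b = y := by
  induction hy using Submodule.span_induction with
  | mem y hy => obtain ⟨c, p, q, hp, hq, -, rfl⟩ := hy; rw [mul_assoc, gpath_mul_vertex hq]
  | zero => simp
  | add x y _ _ hx hy => rw [add_mul, hx, hy]
  | smul k x _ hx => rw [smul_mul_assoc, hx]

/-- If `b` emits edges, then `y = ∑ y e e*`, so some `y e` stays outside `P`, and `e` cancels one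
ghost edge from each term that has one. At a sink there are no ghost edges to remove. -/
theorem exists_mul_mem_ghostDegreeLE_zero (hE : E.RowFinite) {n : ℕ} {y : LeavittPathAlgebra K E}
    (hy : y ∈ ghostDegreeLE K E n a b) (hyP : y ∉ P) :
    ∃ r c, y * r ∈ ghostDegreeLE K E 0 a c ∧ y * r ∉ P := by
  induction n generalizing b y with
  | zero =>
    exact ⟨vertex K E b, b, by rwa [mul_vertex_of_mem_ghostDegreeLE hy],
      by rwa [mul_vertex_of_mem_ghostDegreeLE hy]⟩
  | succ n ih =>
    by_cases hb : (E.src ⁻¹' {b}).Nonempty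
    · obtain ⟨e, he, heP⟩ : ∃ e, E.src e = b ∧ y * edge K E e ∉ P := by
        by_contra! h
        apply hyP
        rw [← mul_vertex_of_mem_ghostDegreeLE hy, vertex_eq_sum (hE b) hb, Finset.mul_sum]
        refine sum_mem fun e he => ?_
        rw [← mul_assoc]
        exact P.mul_mem_right _ _ (h e (by simpa using he))
      subst he
      obtain ⟨r, c, h1, h2⟩ := ih (mul_edge_mem_ghostDegreeLE hy) heP
      exact ⟨edge K E e * r, c, by rwa [← mul_assoc], by rwa [← mul_assoc]⟩
    · exact ⟨vertex K E b, b,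
        by rw [mul_vertex_of_mem_ghostDegreeLE hy]; exact ghostDegreeLE_le_zero_of_sink hb hy,
        by rwa [mul_vertex_of_mem_ghostDegreeLE hy]⟩

variable (K E) in
/-- The span of the closed paths of positive length based at `a`. -/
noncomputable def closedSpan (a : V) : Submodule K (LeavittPathAlgebra K E) :=
  Submodule.span K (path K E a '' {t | E.IsClosedPath a t})

theorem ghostDegreeLE_zero (a c : V) :
    ghostDegreeLE K E 0 a c = Submodule.span K (path K E a '' {p | E.IsPath a p c}) := by
  rw [ghostDegreeLE]
  congr 1
  ext x
  constructor
  · rintro ⟨d, p, q, hp, hq, hl, rfl⟩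
    obtain rfl : q = [] := by simpa using hl
    cases hq
    exact ⟨p, hp, by rw [gpath_nil, path_mul_vertex hp]⟩
  · rintro ⟨p, hp, rfl⟩
    exact ⟨c, p, [], hp, rfl, le_rfl, by rw [gpath_nil, path_mul_vertex hp]⟩

/-- The ghost edges are cleared on the right, then a path is stripped on the left. Primeness plays
no role, so the lemma also applies to `gradedPart P`. -/
theorem exists_reduction (hE : E.RowFinite) {x : LeavittPathAlgebra K E} (hx : x ∉ P) :
    ∃ (l r : LeavittPathAlgebra K E) (c : V) (k : K), k ≠ 0 ∧ vertex K E c ∉ P ∧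
      ∃ z ∈ closedSpan K E c, l * x * r = k • vertex K E c + z := by
  classical
  obtain ⟨a, ha⟩ := exists_vertex_mul_notMem hx
  obtain ⟨b, hb⟩ := exists_mul_vertex_notMem ha
  obtain ⟨n, hn⟩ := exists_mem_ghostDegreeLE a b x
  obtain ⟨r, c, hr, hrP⟩ := exists_mul_mem_ghostDegreeLE_zero hE hn hb
  have hrc := mul_vertex_of_mem_ghostDegreeLE hr
  rw [ghostDegreeLE_zero, Finsupp.mem_span_image_iff_linearCombination] at hr
  obtain ⟨f, hf, hfx⟩ := hr
  have hf0 : f.support.Nonempty := by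
    rw [Finsupp.support_nonempty_iff]
    rintro rfl
    exact hrP (by rw [← hfx, map_zero]; exact P.zero_mem)
  -- Take `p` shortest in the support: `p*` sends `p` to the vertex `c`, and every other path to a
  -- closed path if it extends `p`, and to zero otherwise.
  obtain ⟨p, hp, hmin⟩ := Finset.exists_min_image f.support List.length hf0
  have hpath : ∀ q ∈ f.support, E.IsPath a q c := fun q hq => hf hq
  refine ⟨gpath K E a p * vertex K E a, vertex K E b * r, c, f p, by simpa using hp, fun hc => hrP ?_,
    ∑ q ∈ f.support.erase p, f q • (gpath K E a p * path K E a q), ?_, ?_⟩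
  · rw [← hrc]; exact P.mul_mem_left _ _ hc
  · refine sum_mem fun q hq => Submodule.smul_mem _ _ ?_
    rw [Finset.mem_erase] at hq
    by_cases hpq : p <+: q
    · obtain ⟨t, rfl⟩ := hpq
      have ht := (hpath _ hq.2).of_append_left (hpath _ hp)
      rw [gpath_mul_path_append (hpath _ hp) ht]
      exact Submodule.subset_span ⟨t, ⟨fun h => hq.1 (by simp [h]), ht⟩, rfl⟩
    · rw [gpath_mul_path_eq_zero (hpath _ hp) (hpath _ hq.2) (hmin q hq.2) hpq]
      exact zero_mem _
  · have : gpath K E a p * vertex K E a * x * (vertex K E b * r) =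
        gpath K E a p * (vertex K E a * x * vertex K E b * r) := by simp only [mul_assoc]
    rw [this, ← hfx, Finsupp.linearCombination_apply, Finsupp.sum, Finset.mul_sum,
      ← Finset.add_sum_erase _ _ hp]
    simp only [mul_smul_comm, gpath_mul_path (hpath _ hp)]

/-- Conjugation by a path turns closed paths into closed paths or zero. -/
theorem gpath_mul_closed_mul_path {t : List X} (ht : E.IsClosedPath a t) (hp : E.IsPath a p b) :
    gpath K E a p * path K E a t * path K E a p = 0 ∨
    ∃ t', E.IsClosedPath b t' ∧
      gpath K E a p * path K E a t * path K E a p = path K E b t' := by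
  rw [mul_assoc, ← path_append ht.2 hp]
  by_cases h : p <+: t ++ p
  · right
    obtain ⟨t', ht'⟩ := h
    have hb : E.IsPath b t' b := by
      refine IsPath.of_append_left (a := a) (p := p) ?_ hp
      rw [ht']; exact ht.2.append hp
    refine ⟨t', ⟨?_, hb⟩, ?_⟩
    · rintro rfl
      exact ht.1 (by simpa using ht')
    · rw [← ht', gpath_mul_path_append hp hb]
  · left
    exact gpath_mul_path_eq_zero hp (ht.2.append hp) (by simp) h

theorem gpath_mul_mul_path_mem_closedSpan {z : LeavittPathAlgebra K E}
    (hz : z ∈ closedSpan K E a) (hp : E.IsPath a p b) :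
    gpath K E a p * z * path K E a p ∈ closedSpan K E b := by
  induction hz using Submodule.span_induction with
  | mem z hz =>
    obtain ⟨t, ht, rfl⟩ := hz
    rcases gpath_mul_closed_mul_path (K := K) ht hp with h | ⟨t', ht', h⟩
    · rw [h]; exact zero_mem _
    · rw [h]; exact Submodule.subset_span ⟨t', ht', rfl⟩
  | zero => simp
  | add x y _ _ hx hy => rw [mul_add, add_mul]; exact add_mem hx hy
  | smul k x _ hx => rw [mul_smul_comm, smul_mul_assoc]; exact Submodule.smul_mem _ _ hx

/-! ### The case in which all cycles have exits -/

theorem exists_isExit_of_isClosedPath (hM : E.CyclesHaveExitsIn (verticesOutside P))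
    (ha : vertex K E a ∉ P) {t : List X} (ht : E.IsClosedPath a t) :
    ∃ f, vertex K E (E.rng f) ∉ P ∧ E.IsExit f t := by
  obtain ⟨c, hc, hct⟩ := exists_isCycle_subset _ ht rfl
  have hin : ∀ e ∈ t, E.EdgeIn (verticesOutside P) e := fun e he => by
    obtain ⟨⟨p, hp⟩, ⟨q, hq⟩⟩ := ht.2.reaches_of_mem he
    exact ⟨fun h => ha (mem_of_isPath hp h), fun h => ha (mem_of_isPath hq h)⟩
  obtain ⟨f, hf, e, he, h⟩ := hM c hc fun e he => hin e (hct he)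
  exact ⟨f, hf.2, e, hct he, h⟩

/-- Follow `t` as far as an exit and leave through it. The resulting path `p` diverges from `t`, so
it is no prefix of `t p`, and `p* t p = 0`. -/
theorem exists_path_kill_closed (hM : E.CyclesHaveExitsIn (verticesOutside P))
    (ha : vertex K E a ∉ P) {t : List X} (ht : E.IsClosedPath a t) :
    ∃ p b, E.IsPath a p b ∧ vertex K E b ∉ P ∧
      gpath K E a p * path K E a t * path K E a p = 0 := by
  obtain ⟨f, hf, e, he, hfe, hne⟩ := exists_isExit_of_isClosedPath hM ha ht
  obtain ⟨t₁, t₂, rfl⟩ := List.append_of_mem he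
  obtain ⟨d, h1, h2⟩ := isPath_append.1 ht.2
  have hp : E.IsPath a (t₁ ++ [f]) (E.rng f) := h1.append ⟨hfe.trans h2.1, rfl⟩
  refine ⟨t₁ ++ [f], E.rng f, hp, hf, ?_⟩
  rw [mul_assoc, ← path_append ht.2 hp]
  refine gpath_mul_path_eq_zero hp (ht.2.append hp) (by simp) fun h => hne ?_
  rw [List.append_assoc, List.prefix_append_right_inj] at h
  simpa using h

/-- Conjugation by a path leaves each closed path closed or zero, so the members of `T` can be
killed one after the other along a lengthening path. -/
theorem exists_path_kill_finset (hM : E.CyclesHaveExitsIn (verticesOutside P))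
    (ha : vertex K E a ∉ P) (T : Finset (List X)) (hT : ∀ t ∈ T, E.IsClosedPath a t) :
    ∃ p b, E.IsPath a p b ∧ vertex K E b ∉ P ∧
      ∀ t ∈ T, gpath K E a p * path K E a t * path K E a p = 0 := by
  classical
  induction T using Finset.induction_on with
  | empty => exact ⟨[], a, rfl, ha, by simp⟩
  | insert t T _ ih =>
    obtain ⟨p, b, hp, hb, hkill⟩ := ih fun t ht => hT t (Finset.mem_insert_of_mem ht)
    obtain ⟨q, c, hq, hc, hqk⟩ : ∃ q c, E.IsPath b q c ∧ vertex K E c ∉ P ∧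
        gpath K E b q * (gpath K E a p * path K E a t * path K E a p) * path K E b q = 0 := by
      rcases gpath_mul_closed_mul_path (K := K) (hT t (Finset.mem_insert_self ..)) hp with
        h | ⟨t', ht', h⟩
      · exact ⟨[], b, rfl, hb, by rw [h]; simp⟩
      · rw [h]; exact exists_path_kill_closed hM hb ht'
    refine ⟨p ++ q, c, hp.append hq, hc, fun s hs => ?_⟩
    have : gpath K E a (p ++ q) * path K E a s * path K E a (p ++ q) =
        gpath K E b q * (gpath K E a p * path K E a s * path K E a p) * path K E b q := by
      rw [gpath_append hp hq, path_append hp hq]; simp only [mul_assoc]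
    rw [this]
    rcases Finset.mem_insert.1 hs with rfl | hs
    · exact hqk
    · rw [hkill s hs, mul_zero, zero_mul]

/-- Conjugating the reduced form `k c + z` of `x` by a path that kills `z` leaves `k` times the
final vertex of that path. -/
theorem exists_vertex_mem_of_notMem (hE : E.RowFinite)
    (hM : E.CyclesHaveExitsIn (verticesOutside P)) {x : LeavittPathAlgebra K E} (hx : x ∉ P)
    {Q : TwoSidedIdeal (LeavittPathAlgebra K E)} (hxQ : x ∈ Q) :
    ∃ a, vertex K E a ∉ P ∧ vertex K E a ∈ Q := by
  classical
  obtain ⟨l, r, c, k, hk, hc, z, hz, hlr⟩ := exists_reduction hE hx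
  obtain ⟨T, hT, hzT⟩ := Submodule.mem_span_finite_of_mem_span hz
  obtain ⟨T, hT', rfl⟩ := Finset.subset_set_image_iff.1 hT
  obtain ⟨p, b, hp, hb, hkill⟩ := exists_path_kill_finset hM hc T fun t ht => hT' ht
  refine ⟨b, hb, (smul_mem_iff hk).1 ?_⟩
  have hz0 : gpath K E c p * z * path K E c p = 0 := by
    clear hlr hz
    induction hzT using Submodule.span_induction with
    | mem z hz =>
      obtain ⟨t, ht, rfl⟩ := Finset.mem_image.1 (Finset.mem_coe.1 hz)
      exact hkill t ht
    | zero => simp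
    | add x y _ _ hx hy => rw [mul_add, add_mul, hx, hy, add_zero]
    | smul k x _ hx => rw [mul_smul_comm, smul_mul_assoc, hx, smul_zero]
  have : gpath K E c p * (l * x * r) * path K E c p = k • vertex K E b := by
    rw [hlr, mul_add, add_mul, hz0, add_zero, mul_smul_comm, smul_mul_assoc, gpath_mul_vertex hp,
      gpath_mul_path hp]
  rw [← this]
  exact Q.mul_mem_right _ _ (Q.mul_mem_left _ _ (Q.mul_mem_right _ _ (Q.mul_mem_left _ _ hxQ)))

end LeavittPathAlgebra

/-! ### Cofinal path sequences, and primitivity when cycles have exits -/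

namespace DirectedGraph

variable {V : Type u} {X : Type v} {E : DirectedGraph V X}

/-- This permits an enumeration of the vertices below `a` even if the graph is uncountable. -/
theorem RowFinite.countable_reaches (hE : E.RowFinite) (a : V) : {b | E.Reaches a b}.Countable := by
  suffices h : ∀ n : ℕ, {b | ∃ p : List X, p.length = n ∧ E.IsPath a p b}.Countable by
    refine (Set.countable_iUnion h).mono ?_
    rintro b ⟨p, hp⟩
    exact Set.mem_iUnion.2 ⟨p.length, p, rfl, hp⟩
  intro n
  induction n with
  | zero =>
    refine (Set.countable_singleton a).mono ?_
    rintro b ⟨p, hl, hp⟩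
    obtain rfl : p = [] := by simpa using hl
    exact (isPath_nil.1 hp).symm
  | succ n ih =>
    refine (ih.biUnion fun b _ => ((hE b).image E.rng).countable).mono ?_
    rintro c ⟨p, hl, hp⟩
    obtain ⟨q, e, rfl⟩ : ∃ q e, p = q ++ [e] :=
      ⟨p.dropLast, p.getLast (by rintro rfl; simp at hl), (List.dropLast_append_getLast _).symm⟩
    obtain ⟨b, hq, he, hc⟩ := isPath_append.1 hp
    exact Set.mem_biUnion (show b ∈ _ from ⟨q, by simpa using hl, hq⟩) ⟨e, he, hc⟩

end DirectedGraph

namespace LeavittPathAlgebra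
open DirectedGraph

variable {K : Type w} [Field K] {V : Type u} {X : Type v} {E : DirectedGraph V X}
  {P : TwoSidedIdeal (LeavittPathAlgebra K E)}

/-- A sequence of longer and longer paths in a maximal tail, all starting at `a`, that passes below
every vertex that is reached from `a`. -/
theorem exists_path_sequence (hE : E.RowFinite) {M : Set V} (hM : E.IsMaximalTail M) {a : V}
    (ha : a ∈ M) : ∃ (p : ℕ → List X) (b : ℕ → V), p 0 = [] ∧ (∀ n, E.IsPath a (p n) (b n)) ∧
      (∀ n, b n ∈ M) ∧ (∀ n, p n <+: p (n + 1)) ∧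
      ∀ c ∈ M, E.Reaches a c → ∃ n, E.Reaches c (b n) := by
  obtain ⟨w, hw⟩ := ((hE.countable_reaches a).mono
    (Set.inter_subset_left (t := M))).exists_eq_range ⟨a, Reaches.refl a, ha⟩
  have hwM : ∀ n, w n ∈ M := fun n => (hw ▸ Set.mem_range_self n : w n ∈ _ ∩ M).2
  have step : ∀ (n : ℕ) (s : {s : List X × V // E.IsPath a s.1 s.2 ∧ s.2 ∈ M}),
      ∃ s' : {s : List X × V // E.IsPath a s.1 s.2 ∧ s.2 ∈ M},
        s.1.1 <+: s'.1.1 ∧ E.Reaches (w n) s'.1.2 := by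
    rintro n ⟨⟨p, b⟩, hp, hb⟩
    -- Stage `n` extends the path to a common lower bound of its current end and the `n`-th vertex
    -- of the enumeration.
    obtain ⟨y, hy, ⟨q, hq⟩, h2⟩ := hM.directed b hb (w n) (hwM n)
    exact ⟨⟨⟨p ++ q, y⟩, hp.append hq, hy⟩, List.prefix_append .., h2⟩
  choose next hnext using step
  let s : ℕ → {s : List X × V // E.IsPath a s.1 s.2 ∧ s.2 ∈ M} :=
    fun n => Nat.rec ⟨⟨[], a⟩, rfl, ha⟩ next n
  refine ⟨fun n => (s n).1.1, fun n => (s n).1.2, rfl, fun n => (s n).2.1, fun n => (s n).2.2,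
    fun n => (hnext n (s n)).1, fun c hc hac => ?_⟩
  obtain ⟨n, rfl⟩ : c ∈ Set.range w := hw ▸ ⟨hac, hc⟩
  exact ⟨n + 1, (hnext n (s n)).2⟩

theorem isPrimitiveIdeal_of_cyclesHaveExits (hE : E.RowFinite) (hP : IsPrimeTwoSided P)
    (hM : E.CyclesHaveExitsIn (verticesOutside P)) : IsPrimitiveIdeal P := by
  have hT := isMaximalTail_verticesOutside hE hP
  obtain ⟨a, ha⟩ := hT.nonempty
  obtain ⟨p, b, hp0, hp, hb, hpre, hcof⟩ := exists_path_sequence hE hT ha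
  have hstep : ∀ {n x}, gpath K E a (p n) * x ∈ P → gpath K E a (p (n + 1)) * x ∈ P := by
    intro n x hx
    obtain ⟨q, hq⟩ := hpre n
    have hq' := IsPath.of_append_left (hq ▸ hp (n + 1)) (hp n)
    rw [← hq, gpath_append (hp n) hq', mul_assoc]
    exact P.mul_mem_left _ _ hx
  have hmono : ∀ {m n x}, m ≤ n → gpath K E a (p m) * x ∈ P → gpath K E a (p n) * x ∈ P := by
    intro m n x hmn hx
    induction hmn with
    | refl => exact hx
    | step _ ih => exact hstep ih
  -- The conditions `(p n)* x ∈ P` weaken as `n` grows, so their union is closed under addition. It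
  -- omits `a` because no `b n` lies in `P`.
  let R : AddSubgroup (LeavittPathAlgebra K E) :=
    { carrier := {x | ∃ n, gpath K E a (p n) * x ∈ P}
      zero_mem' := ⟨0, by simp [P.zero_mem]⟩
      add_mem' := fun {x y} ⟨m, hm⟩ ⟨n, hn⟩ => ⟨max m n, by
        rw [mul_add]
        exact P.add_mem (hmono (le_max_left ..) hm) (hmono (le_max_right ..) hn)⟩
      neg_mem' := fun ⟨m, hm⟩ => ⟨m, by rw [mul_neg]; exact P.neg_mem hm⟩ }
  have hR : ∀ x, x ∈ R ↔ ∃ n, gpath K E a (p n) * x ∈ P := fun x => Iff.rfl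
  refine isPrimitiveIdeal_of_rightIdeal (vertex_mul_self a) R
    (fun x ⟨n, hn⟩ r => ⟨n, by rw [← mul_assoc]; exact P.mul_mem_right _ _ hn⟩)
    (fun x hx => ⟨0, P.mul_mem_left _ _ hx⟩) (fun ⟨n, hn⟩ => hb n ?_)
    (fun x => ⟨0, ?_⟩) fun Q hPQ hQP => ?_
  · rwa [gpath_mul_vertex (hp n), gpath_mem_iff (hp n)] at hn
  · rw [hp0, gpath_nil, mul_sub, ← mul_assoc, vertex_mul_self, sub_self]
    exact P.zero_mem
  · obtain ⟨x, hxQ, hxP⟩ := SetLike.not_le_iff_exists.1 hQP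
    obtain ⟨c, hc, hcQ⟩ := exists_vertex_mem_of_notMem hE hM hxP hxQ
    obtain ⟨d, hd, had, q, hq⟩ := hT.directed a ha c hc
    obtain ⟨n, q', hq'⟩ := hcof d hd had
    -- The vertex `b n` lies below `c ∈ Q`, so `p p* ∈ Q` for `p = p n`; and `p* (a - p p*) = 0`.
    refine ⟨path K E a (p n) * gpath K E a (p n), ?_, n, ?_⟩
    · exact Q.mul_mem_right _ _ ((path_mem_iff (hp n)).2 (mem_of_isPath (hq.append hq') hcQ))
    · rw [mul_sub, ← mul_assoc, gpath_mul_path (hp n), vertex_mul_gpath (hp n),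
        gpath_mul_vertex (hp n), sub_self]
      exact P.zero_mem

end LeavittPathAlgebra

namespace LeavittPathAlgebra
open DirectedGraph

variable {K : Type w} [Field K] {V : Type u} {X : Type v} {E : DirectedGraph V X}
  {P : TwoSidedIdeal (LeavittPathAlgebra K E)} {a b : V} {c p : List X}

/-! ### Cycles without exits -/

/-- `c` is a cycle with base `a`, outside `P`, and all edges that leave `c` lead into `P`. -/
structure IsExitlessCycle (P : TwoSidedIdeal (LeavittPathAlgebra K E)) (a : V) (c : List X) :
    Prop where
  ne_nil : c ≠ []
  isPath : E.IsPath a c a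
  nodup : (c.map E.src).Nodup
  notMem : vertex K E a ∉ P
  rng_mem : ∀ e ∈ c, ∀ f, E.src f = E.src e → f ≠ e → vertex K E (E.rng f) ∈ P

theorem exists_isExitlessCycle (h : ¬ E.CyclesHaveExitsIn (verticesOutside P)) :
    ∃ a c, IsExitlessCycle P a c := by
  simp only [CyclesHaveExitsIn] at h
  push Not at h
  obtain ⟨c, ⟨hne, ⟨a, ha⟩, hnd⟩, hin, hno⟩ := h
  refine ⟨a, c, hne, ha, hnd, ?_, fun e he f hfe hne => ?_⟩
  · cases c with
    | nil => exact absurd rfl hne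
    | cons e c => rw [← ha.1]; exact (hin e (by simp)).1
  · by_contra hf
    exact hno f ⟨by rw [hfe]; exact (hin e he).1, hf⟩ ⟨e, he, hfe, hne⟩

/-- At each vertex of the path, all but one summand of `v = ∑ e e*` lies in `P`, so modulo `P` the
sum collapses to the edge that the path takes. -/
theorem path_mul_gpath_sub_mem (hE : E.RowFinite) (hp : E.IsPath a p b)
    (h : ∀ e ∈ p, ∀ f, E.src f = E.src e → f ≠ e → vertex K E (E.rng f) ∈ P) :
    vertex K E a - path K E a p * gpath K E a p ∈ P := by
  classical
  induction p generalizing a with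
  | nil => simp [P.zero_mem]
  | cons e p ih =>
    obtain ⟨rfl, hp⟩ := hp
    have h1 : vertex K E (E.src e) - edge K E e * ghost K E e ∈ P := by
      rw [vertex_eq_sum (hE (E.src e)) ⟨e, rfl⟩, ← Finset.add_sum_erase _ _ (a := e) (by simp),
        add_sub_cancel_left]
      refine sum_mem fun f hf => ?_
      simp only [Finset.mem_erase, Set.Finite.mem_toFinset, Set.mem_preimage,
        Set.mem_singleton_iff] at hf
      rw [← edge_mul_rng]
      exact P.mul_mem_right _ _ (P.mul_mem_left _ _ (h e (by simp) f hf.2 hf.1))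
    have h2 := P.mul_mem_left (edge K E e) _ (P.mul_mem_right _ (ghost K E e)
      (ih hp fun e he => h e (by simp [he])))
    convert P.add_mem h1 h2 using 1
    rw [path_cons, gpath_cons, sub_mul, mul_sub, rng_mul_ghost]
    simp only [mul_assoc]
    abel

theorem isPath_flatten_replicate (h : E.IsPath a c a) (n : ℕ) :
    E.IsPath a (List.replicate n c).flatten a := by
  induction n with
  | zero => simp
  | succ n ih => rw [List.replicate_succ, List.flatten_cons]; exact h.append ih

theorem mem_of_mem_flatten_replicate {e : X} {n : ℕ} (h : e ∈ (List.replicate n c).flatten) :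
    e ∈ c := by
  obtain ⟨l, hl, he⟩ := List.mem_flatten.1 h
  rwa [(List.mem_replicate.1 hl).2] at he

theorem flatten_replicate_add (m n : ℕ) :
    (List.replicate (m + n) c).flatten =
      (List.replicate m c).flatten ++ (List.replicate n c).flatten := by
  rw [List.replicate_add, List.flatten_append]

namespace IsExitlessCycle

/-- A path starting at the base of the cycle and ending outside `P` runs along the cycle. -/
theorem exists_append_eq (hc : IsExitlessCycle P a c) (hp : E.IsPath a p b)
    (hb : vertex K E b ∉ P) : ∃ r n, p ++ r = (List.replicate n c).flatten := by
  induction p using List.reverseRecOn generalizing b with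
  | nil => exact ⟨[], 0, by simp⟩
  | append_singleton p e ih =>
    obtain ⟨d, hp', rfl, rfl⟩ := isPath_append.1 hp
    have he : E.IsPath (E.src e) [e] (E.rng e) := ⟨rfl, rfl⟩
    -- `f` is the edge by which the cycle continues after `p`; if `p` exhausts the given power, one
    -- more lap is added.
    obtain ⟨f, r, n, hr⟩ : ∃ f r n, p ++ f :: r = (List.replicate n c).flatten := by
      obtain ⟨r, n, hr⟩ := ih hp' fun h => hb (mem_of_isPath he h)
      cases r with
      | cons f r => exact ⟨f, r, n, hr⟩
      | nil =>
        obtain ⟨f, r, hfr⟩ := List.exists_cons_of_ne_nil hc.ne_nil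
        refine ⟨f, r, n + 1, ?_⟩
        rw [flatten_replicate_add, ← hr, ← hfr]
        simp
    have hf : E.src f = E.src e :=
      (IsPath.of_append_left (q := f :: r)
        (by rw [hr]; exact isPath_flatten_replicate hc.isPath n) hp').1
    obtain rfl : e = f := by
      by_contra hne
      have hfc : f ∈ c := mem_of_mem_flatten_replicate (n := n) (by rw [← hr]; simp)
      exact hb (hc.rng_mem f hfc e hf.symm hne)
    exact ⟨r, n, by simpa using hr⟩

/-- The closed paths at the base of the cycle are the powers of the cycle. -/
theorem eq_flatten_replicate (hc : IsExitlessCycle P a c) (hp : E.IsPath a p a) :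
    ∃ n, p = (List.replicate n c).flatten := by
  induction hl : p.length using Nat.strong_induction_on generalizing p with
  | _ l ih =>
  subst hl
  obtain ⟨r, n, hr⟩ := hc.exists_append_eq hp hc.notMem
  rcases p with - | ⟨e, p⟩
  · exact ⟨0, by simp⟩
  cases n with
  | zero => simp at hr
  | succ n =>
    have h1 : e :: p <+: (List.replicate (n + 1) c).flatten := ⟨r, hr⟩
    have h2 : c <+: (List.replicate (n + 1) c).flatten := by
      rw [List.replicate_succ, List.flatten_cons]; exact List.prefix_append ..
    rcases List.prefix_or_prefix_of_prefix h1 h2 with ⟨s, hs⟩ | ⟨s, hs⟩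
    · cases s with
      | nil => exact ⟨1, by simpa using hs⟩
      -- A closed path that is a proper prefix of `c` would return to `a` inside `c`, against the
      -- distinctness of the sources.
      | cons f s =>
        have hf := (IsPath.of_append_left (q := f :: s) (by rw [hs]; exact hc.isPath) hp).1
        have := hc.nodup
        rw [← hs, List.map_append, List.map_cons, List.map_cons, List.cons_append,
          List.nodup_cons, hp.1, hf] at this
        simp at this
    · have hs' := IsPath.of_append_left (hs ▸ hp) hc.isPath
      obtain ⟨m, hm⟩ := ih s.length (by
        rw [← hs, List.length_append]
        have := List.length_pos_of_ne_nil hc.ne_nil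
        omega) hs' rfl
      exact ⟨m + 1, by rw [List.replicate_succ, List.flatten_cons, ← hm, hs]⟩

end IsExitlessCycle

/-! ### Polynomials in the cycle and the corner at its base -/

variable (K E) in
/-- The value of a polynomial at the closed path `c` with base `a`. -/
noncomputable def pathEval (a : V) (c : List X) : Polynomial K →ₗ[K] LeavittPathAlgebra K E :=
  Polynomial.lsum fun n =>
    LinearMap.toSpanSingleton K _ (path K E a (List.replicate n c).flatten)

theorem pathEval_monomial (n : ℕ) (k : K) :
    pathEval K E a c (Polynomial.monomial n k) =
      k • path K E a (List.replicate n c).flatten := by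
  simp [pathEval]

theorem pathEval_X_pow (n : ℕ) :
    pathEval K E a c (Polynomial.X ^ n) = path K E a (List.replicate n c).flatten := by
  rw [← Polynomial.monomial_one_right_eq_X_pow, pathEval_monomial, one_smul]

theorem pathEval_one : pathEval K E a c 1 = vertex K E a := by
  rw [← pow_zero Polynomial.X, pathEval_X_pow]; simp

theorem pathEval_mul (hc : E.IsPath a c a) (f g : Polynomial K) :
    pathEval K E a c (f * g) = pathEval K E a c f * pathEval K E a c g := by
  induction f using Polynomial.induction_on' with
  | add f₁ f₂ h₁ h₂ => rw [add_mul, map_add, map_add, h₁, h₂, add_mul]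
  | monomial m k =>
    induction g using Polynomial.induction_on' with
    | add g₁ g₂ h₁ h₂ => rw [mul_add, map_add, map_add, h₁, h₂, mul_add]
    | monomial n l =>
      rw [Polynomial.monomial_mul_monomial, pathEval_monomial, pathEval_monomial,
        pathEval_monomial, flatten_replicate_add, path_append (isPath_flatten_replicate hc m)
        (isPath_flatten_replicate hc n), smul_mul_assoc, mul_smul_comm, smul_smul]

theorem vertex_mul_pathEval (hc : E.IsPath a c a) (f : Polynomial K) :
    vertex K E a * pathEval K E a c f = pathEval K E a c f := by
  rw [← pathEval_one (c := c), ← pathEval_mul hc, one_mul]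

theorem pathEval_mul_vertex (hc : E.IsPath a c a) (f : Polynomial K) :
    pathEval K E a c f * vertex K E a = pathEval K E a c f := by
  rw [← pathEval_one (c := c), ← pathEval_mul hc, mul_one]

theorem proj_pathEval (hc : E.IsPath a c a) (hne : c ≠ []) (f : Polynomial K) (n : ℕ) :
    proj K E (n * c.length) (pathEval K E a c f) =
      f.coeff n • path K E a (List.replicate n c).flatten := by
  induction f using Polynomial.induction_on' with
  | add f g hf hg => rw [map_add, map_add, hf, hg, Polynomial.coeff_add, add_smul]
  | monomial m k =>
    rw [pathEval_monomial, map_smul, proj_path (isPath_flatten_replicate hc m),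
      Polynomial.coeff_monomial]
    have hl : (c.length : ℤ) ≠ 0 := by simpa using hne
    by_cases h : m = n
    · subst h; simp
    · rw [if_neg h, if_neg, smul_zero, zero_smul]
      simp only [List.length_flatten, List.map_replicate, List.sum_replicate, smul_eq_mul,
        Nat.cast_mul]
      intro h'
      exact h (by exact_mod_cast (mul_right_cancel₀ hl h').symm)

namespace IsExitlessCycle

/-- Distinct powers of `c` have distinct degrees, so a graded ideal would contain each term of
`f(c)`, hence a power of `c`, hence its base. -/
theorem eq_zero_of_pathEval_mem (hc : IsExitlessCycle P a c) (hP : IsGradedIdeal P)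
    {f : Polynomial K} (hf : pathEval K E a c f ∈ P) : f = 0 := by
  ext n
  by_contra hn
  have := isGradedIdeal_iff.1 hP _ hf (n * c.length)
  rw [proj_pathEval hc.isPath hc.ne_nil, smul_mem_iff (by simpa using hn),
    path_mem_iff (isPath_flatten_replicate hc.isPath n)] at this
  exact hc.notMem this

theorem vertex_sub_mem (hE : E.RowFinite) (hc : IsExitlessCycle P a c) (n : ℕ) :
    vertex K E a - pathEval K E a c (Polynomial.X ^ n) *
      gpath K E a (List.replicate n c).flatten ∈ P := by
  rw [pathEval_X_pow]
  exact path_mul_gpath_sub_mem hE (isPath_flatten_replicate hc.isPath n) fun e he =>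
    hc.rng_mem e (mem_of_mem_flatten_replicate he)

/-- Modulo `P`, the ghost of `c ^ n` is a right inverse of `c ^ n`, so powers of `c` cancel on the
right. -/
theorem mul_vertex_mem (hE : E.RowFinite) (hc : IsExitlessCycle P a c) {n : ℕ}
    {x : LeavittPathAlgebra K E} (hx : x * pathEval K E a c (Polynomial.X ^ n) ∈ P) :
    x * vertex K E a ∈ P := by
  have h1 := P.mul_mem_left x _ (hc.vertex_sub_mem hE n)
  rw [mul_sub, ← mul_assoc] at h1
  simpa using P.add_mem h1
    (P.mul_mem_right _ (gpath K E a (List.replicate n c).flatten) hx)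

/-- Modulo `P`, the corner at the base of the cycle consists of Laurent polynomials in the
cycle. -/
theorem exists_pathEval (hc : IsExitlessCycle P a c) (x : LeavittPathAlgebra K E) :
    ∃ n f, vertex K E a * x * vertex K E a * pathEval K E a c (Polynomial.X ^ n) -
      pathEval K E a c f ∈ P := by
  induction x using monomial_induction with
  | zero => exact ⟨0, 0, by simp [P.zero_mem]⟩
  | add x y hx hy =>
    obtain ⟨m, f, hf⟩ := hx
    obtain ⟨n, g, hg⟩ := hy
    refine ⟨m + n, f * Polynomial.X ^ n + g * Polynomial.X ^ m, ?_⟩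
    convert P.add_mem (P.mul_mem_right _ (pathEval K E a c (Polynomial.X ^ n)) hf)
      (P.mul_mem_right _ (pathEval K E a c (Polynomial.X ^ m)) hg) using 1
    rw [sub_mul, sub_mul, mul_assoc _ (pathEval K E a c _), mul_assoc _ (pathEval K E a c _),
      ← pathEval_mul hc.isPath, ← pathEval_mul hc.isPath, ← pathEval_mul hc.isPath,
      ← pathEval_mul hc.isPath, ← pow_add, ← pow_add, add_comm n m, map_add, mul_add, add_mul,
      add_mul]
    abel
  | smul k x hx =>
    obtain ⟨n, f, hf⟩ := hx
    refine ⟨n, k • f, ?_⟩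
    rw [map_smul, mul_smul_comm, smul_mul_assoc, smul_mul_assoc, ← smul_sub]
    exact smul_mem k hf
  | monomial x hx =>
    obtain ⟨a', b', d, p, q, hp, hq, rfl⟩ := hx
    by_cases h1 : a = a'
    · by_cases h2 : a = b'
      · subst h1 h2
        rw [← mul_assoc, vertex_mul_path hp, mul_assoc (path ..), gpath_mul_vertex hq]
        by_cases hd : vertex K E d ∈ P
        · refine ⟨0, 0, ?_⟩
          rw [map_zero, sub_zero]
          exact P.mul_mem_right _ _ (P.mul_mem_right _ _ ((path_mem_iff hp).2 hd))
        -- Completing `q` to a power `q r = c ^ n` gives `p q* c ^ n = p r`, a closed path at `a`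
        -- and thus a power of `c`.
        · obtain ⟨r, n, hr⟩ := hc.exists_append_eq hq hd
          have hra := IsPath.of_append_left (hr ▸ isPath_flatten_replicate hc.isPath n) hq
          obtain ⟨m, hm⟩ := hc.eq_flatten_replicate (hp.append hra)
          refine ⟨n, Polynomial.X ^ m, ?_⟩
          rw [pathEval_X_pow, pathEval_X_pow, ← hr, mul_assoc, gpath_mul_path_append hq hra,
            ← path_append hp hra, hm, sub_self]
          exact P.zero_mem
      · refine ⟨0, 0, ?_⟩
        rw [← mul_assoc, mul_assoc (_ * _) (gpath K E b' q), gpath_mul_vertex_of_ne hq h2]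
        simp [P.zero_mem]
    · refine ⟨0, 0, ?_⟩
      rw [← mul_assoc, vertex_mul_path_of_ne hp h1]
      simp [P.zero_mem]

variable (P) in
/-- The polynomials whose value at the cycle lies in `P`. -/
noncomputable def evalIdeal (hc : E.IsPath a c a) : Ideal (Polynomial K) where
  carrier := {f | pathEval K E a c f ∈ P}
  zero_mem' := by simp [P.zero_mem]
  add_mem' hf hg := by
    rw [Set.mem_ofPred_eq, map_add]
    exact P.add_mem hf hg
  smul_mem' f g hg := by
    rw [Set.mem_ofPred_eq, smul_eq_mul, pathEval_mul hc]
    exact P.mul_mem_left _ _ hg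

theorem mem_evalIdeal {hc : E.IsPath a c a} {f : Polynomial K} :
    f ∈ evalIdeal P hc ↔ pathEval K E a c f ∈ P := Iff.rfl

/-- The corner commutes modulo `P`: after multiplication by a power of `c`, `f(c) r g(c)` becomes
`(f g)(c) s(c)` for a polynomial `s`. So `(f g)(c) ∈ P` puts every `f(c) r g(c)` in `P`. -/
theorem isPrime_evalIdeal (hE : E.RowFinite) (hc : IsExitlessCycle P a c)
    (hP : IsPrimeTwoSided P) : (evalIdeal P hc.isPath).IsPrime where
  ne_top' h := by
    have : (1 : Polynomial K) ∈ evalIdeal P hc.isPath := h ▸ Submodule.mem_top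
    rw [mem_evalIdeal, pathEval_one] at this
    exact hc.notMem this
  mem_or_mem' {f g} hfg := by
    by_contra! h
    obtain ⟨r, hr⟩ := exists_mul_mul_notMem hP h.1 h.2
    apply hr
    obtain ⟨n, s, hs⟩ := hc.exists_pathEval r
    rw [← pathEval_mul_vertex hc.isPath f, ← vertex_mul_pathEval hc.isPath g,
      ← pathEval_mul_vertex hc.isPath g, ← mul_assoc, ← mul_assoc]
    refine hc.mul_vertex_mem hE (n := n) ?_
    have h1 := P.mul_mem_left (pathEval K E a c f) _ (P.mul_mem_right _ (pathEval K E a c g) hs)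
    have h2 := P.mul_mem_right _ (pathEval K E a c s) hfg
    rw [← pathEval_mul hc.isPath] at h2
    convert P.add_mem h1 h2 using 1
    rw [sub_mul, mul_sub, ← pathEval_mul hc.isPath s, ← pathEval_mul hc.isPath f, mul_comm s,
      mul_assoc f, sub_add_cancel, mul_assoc _ (pathEval K E a c g), ← pathEval_mul hc.isPath g,
      mul_comm g, pathEval_mul hc.isPath]
    simp only [mul_assoc]

theorem exists_pathEval_eq_of_mem_closedSpan (hc : IsExitlessCycle P a c)
    {z : LeavittPathAlgebra K E} (hz : z ∈ closedSpan K E a) :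
    ∃ f : Polynomial K, f.coeff 0 = 0 ∧ pathEval K E a c f = z := by
  induction hz using Submodule.span_induction with
  | mem z hz =>
    obtain ⟨t, ht, rfl⟩ := hz
    obtain ⟨n, rfl⟩ := hc.eq_flatten_replicate ht.2
    refine ⟨Polynomial.X ^ n, ?_, pathEval_X_pow n⟩
    rw [Polynomial.coeff_X_pow, if_neg]
    rintro rfl
    exact ht.1 (by simp)
  | zero => exact ⟨0, by simp⟩
  | add x y _ _ hx hy =>
    obtain ⟨f, hf, rfl⟩ := hx
    obtain ⟨g, hg, rfl⟩ := hy
    exact ⟨f + g, by simp [hf, hg], map_add ..⟩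
  | smul k x _ hx =>
    obtain ⟨f, hf, rfl⟩ := hx
    exact ⟨k • f, by simp [hf], map_smul ..⟩

theorem evalIdeal_ne_bot (hE : E.RowFinite) (hc : IsExitlessCycle P a c)
    (hP : IsPrimeTwoSided P) (hgr : ¬ IsGradedIdeal P) : evalIdeal P hc.isPath ≠ ⊥ := by
  rw [isGradedIdeal_iff] at hgr
  push Not at hgr
  obtain ⟨x, hx, n, hn⟩ := hgr
  have hxJ : x ∉ gradedPart P := fun h => hn (mem_gradedPart.1 h n)
  -- Reduction is modulo `gradedPart P`, which has the same vertices as `P`, while `x` itself lies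
  -- in `P`. The reduced form is then transported to `a` along a path `p ++ s`, which exists because
  -- `d` and `a` have a common lower bound and paths from `a` outside `P` can return to `a`.
  obtain ⟨l, r, d, k, hk, hd, z, hz, hlr⟩ := exists_reduction hE hxJ
  rw [vertex_mem_gradedPart] at hd
  obtain ⟨y, hy, ⟨p, hp⟩, ⟨q, hq⟩⟩ :=
    (isMaximalTail_verticesOutside hE hP).directed d hd a hc.notMem
  obtain ⟨s, m, hs⟩ := hc.exists_append_eq hq hy
  have hps := hp.append (IsPath.of_append_left (hs ▸ isPath_flatten_replicate hc.isPath m) hq)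
  obtain ⟨f, hf0, hf⟩ :=
    hc.exists_pathEval_eq_of_mem_closedSpan (gpath_mul_mul_path_mem_closedSpan hz hps)
  rw [Submodule.ne_bot_iff]
  refine ⟨k • 1 + f, ?_, fun h => hk ?_⟩
  · rw [mem_evalIdeal, map_add, map_smul, pathEval_one, hf]
    have : k • vertex K E a + gpath K E d (p ++ s) * z * path K E d (p ++ s) =
        gpath K E d (p ++ s) * (l * x * r) * path K E d (p ++ s) := by
      rw [hlr, mul_add, add_mul, mul_smul_comm, smul_mul_assoc, gpath_mul_vertex hps,
        gpath_mul_path hps]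
    rw [this]
    exact P.mul_mem_right _ _ (P.mul_mem_left _ _ (P.mul_mem_right _ _ (P.mul_mem_left _ _ hx)))
  · simpa [hf0] using congrArg (Polynomial.coeff · 0) h

/-- An ideal `Q` strictly above `P` meets the corner outside `P`, so `evalIdeal Q` strictly contains
the maximal ideal `evalIdeal P`. Hence it contains `1`, that is, `a ∈ Q`. -/
theorem isPrimitiveIdeal (hE : E.RowFinite) (hc : IsExitlessCycle P a c)
    (hP : IsPrimeTwoSided P) (hgr : ¬ IsGradedIdeal P) : IsPrimitiveIdeal P := by
  have hmax := (hc.isPrime_evalIdeal hE hP).isMaximal (hc.evalIdeal_ne_bot hE hP hgr)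
  let R : AddSubgroup (LeavittPathAlgebra K E) :=
    { carrier := {x | vertex K E a * x ∈ P}
      zero_mem' := by simp [P.zero_mem]
      add_mem' := fun hx hy => by rw [Set.mem_ofPred_eq, mul_add]; exact P.add_mem hx hy
      neg_mem' := fun hx => by rw [Set.mem_ofPred_eq, mul_neg]; exact P.neg_mem hx }
  have hR : ∀ x, x ∈ R ↔ vertex K E a * x ∈ P := fun x => Iff.rfl
  refine isPrimitiveIdeal_of_rightIdeal (vertex_mul_self a) R
    (fun x hx r => ?_) (fun x hx => P.mul_mem_left _ _ hx) (fun h => ?_) (fun x => ?_)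
    fun Q hPQ hQP => ⟨vertex K E a, ?_, by rw [sub_self]; exact R.zero_mem⟩
  · rw [hR, ← mul_assoc]; exact P.mul_mem_right _ _ hx
  · rw [hR, vertex_mul_self] at h; exact hc.notMem h
  · rw [hR, mul_sub, ← mul_assoc, vertex_mul_self, sub_self]; exact P.zero_mem
  · obtain ⟨x, hxQ, hxP⟩ := SetLike.not_le_iff_exists.1 hQP
    obtain ⟨r, hr⟩ := exists_mul_mul_notMem hP hc.notMem hxP
    obtain ⟨s, hs⟩ := exists_mul_mul_notMem hP hr hc.notMem
    obtain ⟨n, f, hf⟩ := hc.exists_pathEval (r * x * s)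
    have hy : vertex K E a * (r * x * s) * vertex K E a ∈ Q :=
      Q.mul_mem_right _ _ (Q.mul_mem_left _ _ (Q.mul_mem_right _ _ (Q.mul_mem_left _ _ hxQ)))
    have hfQ : f ∈ evalIdeal Q hc.isPath := by
      rw [mem_evalIdeal]
      simpa using Q.sub_mem (Q.mul_mem_right _ (pathEval K E a c (Polynomial.X ^ n)) hy) (hPQ hf)
    have hfP : f ∉ evalIdeal P hc.isPath := fun h => hs (by
      have := hc.mul_vertex_mem hE (by simpa using P.add_mem hf h)
      rw [mul_assoc _ (vertex K E a), vertex_mul_self] at this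
      simpa only [mul_assoc] using this)
    have htop : evalIdeal Q hc.isPath = ⊤ := hmax.1.2 _
      (lt_of_le_of_ne (fun g hg => hPQ hg) fun h => hfP (h ▸ hfQ))
    have : (1 : Polynomial K) ∈ evalIdeal Q hc.isPath := htop ▸ Submodule.mem_top
    rwa [mem_evalIdeal, pathEval_one] at this

end IsExitlessCycle

end LeavittPathAlgebra

/-! ### Graded ideals with an exitless cycle are not primitive -/

/-- Both `s A` and the set `Z` of elements annihilated by `A` are submodules. If `s A = 0`, then `Z`
contains `s ≠ 0`, so it is everything, against `S A ≠ 0`. -/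
theorem IsSimpleRightModule.exists_eq {A : Type u} [NonUnitalRing A] {S : Type v} [AddCommGroup S]
    {ρ : Aᵐᵒᵖ →ₙ+* AddMonoid.End S} (h : IsSimpleRightModule ρ) {s : S} (hs : s ≠ 0) (t : S) :
    ∃ x, ρ (.op x) s = t := by
  have hmul : ∀ x y s, ρ (.op y) (ρ (.op x) s) = ρ (.op (x * y)) s := fun x y s => by
    rw [MulOpposite.op_mul, map_mul]; rfl
  let N : AddSubgroup S :=
    { carrier := {t | ∃ x, ρ (.op x) s = t}
      zero_mem' := ⟨0, by simp⟩
      add_mem' := fun ⟨x, hx⟩ ⟨y, hy⟩ => ⟨x + y, by rw [← hx, ← hy, MulOpposite.op_add, map_add]; rfl⟩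
      neg_mem' := fun ⟨x, hx⟩ => ⟨-x, by rw [← hx, MulOpposite.op_neg, map_neg]; rfl⟩ }
  let Z : AddSubgroup S :=
    { carrier := {t | ∀ x, ρ (.op x) t = 0}
      zero_mem' := fun x => by simp
      add_mem' := fun ht ht' x => by rw [map_add, ht x, ht' x, add_zero]
      neg_mem' := fun ht x => by rw [map_neg, ht x, neg_zero] }
  rcases h.2 N fun y t ⟨x, hx⟩ => ⟨x * y, by rw [← hx, hmul]⟩ with hN | hN
  · have hsZ : s ∈ Z := fun x => by
      have : ρ (.op x) s ∈ N := ⟨x, rfl⟩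
      rwa [hN] at this
    rcases h.2 Z fun y t ht => by rw [ht y]; exact Z.zero_mem with hZ | hZ
    · rw [hZ] at hsZ; exact absurd hsZ hs
    · obtain ⟨x, t, hxt⟩ := h.1
      exact absurd ((hZ ▸ AddSubgroup.mem_top t : t ∈ Z) x) hxt
  · exact (hN ▸ AddSubgroup.mem_top t : t ∈ N)

namespace LeavittPathAlgebra
open DirectedGraph

variable {K : Type w} [Field K] {V : Type u} {X : Type v} {E : DirectedGraph V X}
  {P : TwoSidedIdeal (LeavittPathAlgebra K E)} {a : V} {c : List X}

theorem IsExitlessCycle.not_isPrimitiveIdeal (hE : E.RowFinite) (hc : IsExitlessCycle P a c)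
    (hP : IsGradedIdeal P) : ¬ IsPrimitiveIdeal P := by
  rintro ⟨S, _, ρ, hS, hρ⟩
  have hmul : ∀ x y s, ρ (.op (x * y)) s = ρ (.op y) (ρ (.op x) s) := fun x y s => by
    rw [MulOpposite.op_mul, map_mul]; rfl
  have hzero : ∀ {x}, x ∈ P → ∀ s, ρ (.op x) s = 0 := fun hx s => by rw [(hρ _).1 hx]; rfl
  have hcongr : ∀ {x y}, x - y ∈ P → ∀ s, ρ (.op x) s = ρ (.op y) s := fun {x y} h s => by
    rw [← sub_eq_zero, ← hzero h s, MulOpposite.op_sub, map_sub]; rfl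
  have hne : ∀ {f : Polynomial K}, f ≠ 0 → ∃ s, ρ (.op (pathEval K E a c f)) s ≠ 0 := by
    intro f hf
    by_contra! h
    exact hf (hc.eq_zero_of_pathEval_mem hP ((hρ _).2 (AddMonoidHom.ext h)))
  -- `1 - X` serves as a non-unit among the Laurent polynomials: it vanishes at `1`, where no power
  -- of `X` does.
  have hb : (1 - Polynomial.X : Polynomial K) ≠ 0 := fun h => by
    simpa using congrArg (Polynomial.coeff · 0) h
  obtain ⟨s₀, hs₀⟩ := hne hb
  obtain ⟨s, hs⟩ : ∃ s, s = ρ (.op (vertex K E a)) s₀ := ⟨_, rfl⟩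
  have hsa : ρ (.op (vertex K E a)) s = s := by rw [hs, ← hmul, vertex_mul_self]
  have hsb : ρ (.op (pathEval K E a c (1 - Polynomial.X))) s ≠ 0 := by
    rwa [hs, ← hmul, vertex_mul_pathEval hc.isPath]
  have hs0 : s ≠ 0 := by rintro h; rw [h, map_zero] at hsb; exact hsb rfl
  -- the action of `x` on `s` agrees on the corner with that of a Laurent polynomial
  have key : ∀ (f : Polynomial K) (x), ∃ n g,
      ρ (.op (pathEval K E a c f * (vertex K E a * x * vertex K E a) *
        pathEval K E a c (Polynomial.X ^ n))) s = ρ (.op (pathEval K E a c (f * g))) s := by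
    intro f x
    obtain ⟨n, g, hg⟩ := hc.exists_pathEval x
    refine ⟨n, g, hcongr ?_ s⟩
    rw [pathEval_mul hc.isPath, mul_assoc, ← mul_sub]
    exact P.mul_mem_left _ _ hg
  obtain ⟨x, hx⟩ := hS.exists_eq hsb s
  obtain ⟨n, g, hg⟩ := key (1 - Polynomial.X) x
  -- From `s (1 - c) x = s` and `a x a c ^ n ≡ g(c)` follows `s h(c) = 0`. Also `h(1) = 1`, so `h ≠
  -- 0`.
  obtain ⟨h, hh⟩ : ∃ h : Polynomial K, h = Polynomial.X ^ n - (1 - Polynomial.X) * g := ⟨_, rfl⟩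
  have hh0 : h ≠ 0 := fun h0 => by
    simpa using congrArg (Polynomial.eval 1) (hh.symm.trans h0)
  have hhs : ρ (.op (pathEval K E a c h)) s = 0 := by
    have h1 : pathEval K E a c (1 - Polynomial.X) * (vertex K E a * x * vertex K E a) =
        pathEval K E a c (1 - Polynomial.X) * x * vertex K E a := by
      rw [← mul_assoc, ← mul_assoc, pathEval_mul_vertex hc.isPath]
    rw [h1, hmul, hmul, hmul, hx, hsa] at hg
    rw [hh, map_sub, MulOpposite.op_sub, map_sub]
    exact sub_eq_zero.2 hg
  obtain ⟨t, ht⟩ := hne hh0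
  obtain ⟨y, rfl⟩ := hS.exists_eq hs0 t
  apply ht
  -- Since `h(c)` commutes with the corner modulo `P`, `s y h(c) c ^ m = s h(c) g'(c) = 0`.
  -- Cancelling `c ^ m` shows that `h(c)` kills every `s y`, contrary to the choice of `t`.
  obtain ⟨m, g', hg'⟩ := hc.exists_pathEval y
  have h1 : ρ (.op (vertex K E a * y * vertex K E a * pathEval K E a c h *
      pathEval K E a c (Polynomial.X ^ m))) s = 0 := by
    rw [mul_assoc _ (pathEval K E a c _), ← pathEval_mul hc.isPath, mul_comm h, pathEval_mul hc.isPath,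
      ← mul_assoc, hmul, hcongr hg', ← hmul, ← pathEval_mul hc.isPath, mul_comm g',
      pathEval_mul hc.isPath, hmul, hhs, map_zero]
  have h2 := P.mul_mem_left (vertex K E a * y * vertex K E a * pathEval K E a c h) _
    (hc.vertex_sub_mem hE m)
  rw [mul_sub] at h2
  replace h2 := hcongr h2 s
  rw [mul_assoc _ _ (vertex K E a), pathEval_mul_vertex hc.isPath, ← mul_assoc, hmul _ (gpath ..),
    h1, map_zero, mul_assoc _ (vertex K E a), vertex_mul_pathEval hc.isPath, hmul, hmul, hsa] at h2
  exact h2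

end LeavittPathAlgebra

/-! ### The main theorem -/

theorem mainTheorem3 {V : Type*} {X : Type*} (E : DirectedGraph V X) (hE : E.RowFinite)
    (K : Type*) [Field K] :
    (∀ P : TwoSidedIdeal (LeavittPathAlgebra K E),
      IsPrimeTwoSided P → LeavittPathAlgebra.IsGradedIdeal P →
        LeavittPathAlgebra.verticesOutside P ∈ E.maximalTails ∧
        (IsPrimitiveIdeal P ↔ LeavittPathAlgebra.verticesOutside P ∈ E.maximalTailsGamma)) ∧
    (∀ P : TwoSidedIdeal (LeavittPathAlgebra K E),
      IsPrimeTwoSided P → ¬ LeavittPathAlgebra.IsGradedIdeal P → IsPrimitiveIdeal P) := by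
  refine ⟨fun P hP hgr => ?_, fun P hP hgr => ?_⟩
  · have hT := LeavittPathAlgebra.isMaximalTail_verticesOutside hE hP
    refine ⟨hT, fun h => ⟨hT, ?_⟩, fun h =>
      LeavittPathAlgebra.isPrimitiveIdeal_of_cyclesHaveExits hE hP h.2⟩
    by_contra hM
    obtain ⟨a, c, hc⟩ := LeavittPathAlgebra.exists_isExitlessCycle hM
    exact hc.not_isPrimitiveIdeal hE hgr h
  · by_cases hM : E.CyclesHaveExitsIn (LeavittPathAlgebra.verticesOutside P)
    · exact LeavittPathAlgebra.isPrimitiveIdeal_of_cyclesHaveExits hE hP hM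
    · obtain ⟨a, c, hc⟩ := LeavittPathAlgebra.exists_isExitlessCycle hM
      exact hc.isPrimitiveIdeal hE hP hgr
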